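/- Let $C\subset\mathbb R^N$ be a compact convex set with nonempty interior and boundary of class $C^2$, with outward unit normal $\nu$. A thickness function is a positive $C^1$ function $d:\partial C\to(0,\infty)$; put $\Phi_d(c)=c+d(c)\nu(c)$ and $\Omega_d=C\cup\{c+r\nu(c): c\in\partial C,\ 0\le r<d(c)\}$. The return map $F_d$ is defined at $c\in\partial C$ if $\Omega_d$ has an inward unit normal $n$ at $\Phi_d(c)$ and the ray $\{\Phi_d(c)+tn: t\ge 0\}$ meets $C$; then $F_d(c)=\Phi_d(c)+t_*n$, where $t_*$ is the smallest $t\ge0$ with $\Phi_d(c)+tn\in C$. Write $\nabla$ for the Riemannian gradient on $\partial C$ and $V_d=d\,\nabla d$. For every $M$ there are $K,\delta>0$, depending only on $C$ and $M$, such that for every thickness function $d$, every $\lambda>0$ and every $c\in\partial C$ with $\|\nabla d(c)\|\le M$ and $\lambda\|\nabla d(c)\|\le M$ the following hold. 1. (First-order expansions.) $F_d$ is defined at $c$ if $d(c)\le\delta$, and $F_{\lambda d}$ is defined at $c$ if $\lambda d(c)\le\delta$. Wherever they are defined, $$\|F_d(c)-c-V_d(c)\|\le K\,d(c)^2\,\|\nabla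 d(c)\|,\qquad \|F_{\lambda d}(c)-c-V_{\lambda d}(c)\|\le K\,(\lambda d(c))^2\,\lambda\|\nabla d(c)\| .$$ That is, $V_d$ and $V_{\lambda d}$ are the displacements of the two return maps to first order in the thickness. 2. (Same gradient line field.) $\operatorname{span}V_d(c)=\operatorname{span}V_{\lambda d}(c)=\operatorname{span}\nabla d(c)$. 3. (Different speed.) $V_{\lambda d}(c)=\lambda^2V_d(c)$; in particular, if $\lambda\ne1$ and $\nabla d(c)\ne0$, then $\|V_{\lambda d}(c)\|\ne\|V_d(c)\|$. 4. (The discrete maps differ.) If $F_d$ and $F_{\lambda d}$ are both defined at $c$, then $F_{\lambda d}(c)=F_d(c)$ if and only if $\lambda=1$ or $\nabla d(c)=0$. -/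

import Mathlib

open scoped RealInnerProductSpace

noncomputable section

/-- The boundary of `C` is a hypersurface of class `C²`: near each boundary point, `C` is the
sublevel set `{ρ ≤ 0}` of a `C²` function `ρ` whose differential does not vanish there. -/
def HasC2Boundary {N : ℕ} (C : Set (EuclideanSpace ℝ (Fin N))) : Prop :=
  ∀ c ∈ frontier C, ∃ (U : Set (EuclideanSpace ℝ (Fin N)))
    (ρ : EuclideanSpace ℝ (Fin N) → ℝ),
      IsOpen U ∧ c ∈ U ∧ ContDiffOn ℝ 2 ρ U ∧ fderiv ℝ ρ c ≠ 0 ∧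
        ∀ y ∈ U, (y ∈ C ↔ ρ y ≤ 0)

/-- A convex core: a compact convex set with nonempty interior and boundary of class `C²`. -/
structure IsConvexCore {N : ℕ} (C : Set (EuclideanSpace ℝ (Fin N))) : Prop where
  isCompact : IsCompact C
  convex : Convex ℝ C
  interior_nonempty : (interior C).Nonempty
  boundary : HasC2Boundary C

/-- `v` is an outward unit normal at `c` to the convex set `C`. -/
def IsOutwardUnitNormal {N : ℕ} (C : Set (EuclideanSpace ℝ (Fin N)))
    (c v : EuclideanSpace ℝ (Fin N)) : Prop :=
  ‖v‖ = 1 ∧ ∀ y ∈ C, ⟪v, y - c⟫ ≤ 0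

/-- The outward unit normal `ν(c)` to `C` (unique at the boundary points of a convex core). -/
def outwardNormal {N : ℕ} (C : Set (EuclideanSpace ℝ (Fin N)))
    (c : EuclideanSpace ℝ (Fin N)) : EuclideanSpace ℝ (Fin N) :=
  Classical.epsilon (IsOutwardUnitNormal C c)

/-- `g` is the tangential (Riemannian) gradient at `c` of the restriction of `d` to `∂C`: it is
tangent to `∂C`, and `d y = d c + ⟪g, y - c⟫ + o(‖y - c‖)` as `y → c` within `∂C`. -/
def HasSurfaceGradientAt {N : ℕ} (C : Set (EuclideanSpace ℝ (Fin N)))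
    (d : EuclideanSpace ℝ (Fin N) → ℝ) (g c : EuclideanSpace ℝ (Fin N)) : Prop :=
  ⟪g, outwardNormal C c⟫ = 0 ∧ HasGradientWithinAt d g (frontier C) c

/-- The surface gradient `∇_{∂C} d (c)`. -/
def surfaceGradient {N : ℕ} (C : Set (EuclideanSpace ℝ (Fin N)))
    (d : EuclideanSpace ℝ (Fin N) → ℝ) (c : EuclideanSpace ℝ (Fin N)) :
    EuclideanSpace ℝ (Fin N) :=
  Classical.epsilon (fun g => HasSurfaceGradientAt C d g c)

/-- Thickness functions: positive functions of class `C¹` on `∂C`. Only the values of `d` on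
`∂C` matter. -/
structure IsThickness {N : ℕ} (C : Set (EuclideanSpace ℝ (Fin N)))
    (d : EuclideanSpace ℝ (Fin N) → ℝ) : Prop where
  contDiffOn : ContDiffOn ℝ 1 d (frontier C)
  pos : ∀ c ∈ frontier C, 0 < d c

/-- The domain `Ω_d = C ∪ {c + r ν(c) : c ∈ ∂C, 0 ≤ r < d(c)}`. -/
def thickDomain {N : ℕ} (C : Set (EuclideanSpace ℝ (Fin N)))
    (d : EuclideanSpace ℝ (Fin N) → ℝ) : Set (EuclideanSpace ℝ (Fin N)) :=
  C ∪ {x | ∃ c ∈ frontier C, ∃ r : ℝ, 0 ≤ r ∧ r < d c ∧ x = c + r • outwardNormal C c}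

/-- The radial map `Φ_d(c) = c + d(c) ν(c)`. -/
def radialMap {N : ℕ} (C : Set (EuclideanSpace ℝ (Fin N)))
    (d : EuclideanSpace ℝ (Fin N) → ℝ) (c : EuclideanSpace ℝ (Fin N)) :
    EuclideanSpace ℝ (Fin N) :=
  c + d c • outwardNormal C c

/-- `n` is the inward unit normal of `Ω` at the boundary point `x`: `Ω` is asymptotic at `x` to
the half-space `{y : ⟪n, y - x⟫ > 0}`, that is, for every `δ > 0` it contains near `x` all `y`
with `⟪n, y - x⟫ > δ ‖y - x‖` and none with `⟪n, y - x⟫ < -δ ‖y - x‖`. -/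
def IsInwardUnitNormal {N : ℕ} (Ω : Set (EuclideanSpace ℝ (Fin N)))
    (x n : EuclideanSpace ℝ (Fin N)) : Prop :=
  ‖n‖ = 1 ∧ ∀ δ : ℝ, 0 < δ → ∃ r : ℝ, 0 < r ∧ ∀ y, ‖y - x‖ < r →
    (δ * ‖y - x‖ < ⟪n, y - x⟫ → y ∈ Ω) ∧ (⟪n, y - x⟫ < -(δ * ‖y - x‖) → y ∉ Ω)

/-- The inward unit normal `n(x)` of `Ω` at `x` (unique where it exists). -/
def inwardNormal {N : ℕ} (Ω : Set (EuclideanSpace ℝ (Fin N)))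
    (x : EuclideanSpace ℝ (Fin N)) : EuclideanSpace ℝ (Fin N) :=
  Classical.epsilon (IsInwardUnitNormal Ω x)

/-- The reciprocal map `π(x) = x + t(x) n(x)`, where `t(x)` is the smallest `t ≥ 0` with
`x + t n(x) ∈ C`. The infimum is attained when `C` is closed and the ray meets `C`. -/
def reciprocalMap {N : ℕ} (C Ω : Set (EuclideanSpace ℝ (Fin N)))
    (x : EuclideanSpace ℝ (Fin N)) : EuclideanSpace ℝ (Fin N) :=
  x + sInf {t : ℝ | 0 ≤ t ∧ x + t • inwardNormal Ω x ∈ C} • inwardNormal Ω x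

/-- The return map `F_d = π ∘ Φ_d` of the domain `Ω_d`. -/
def returnMap {N : ℕ} (C : Set (EuclideanSpace ℝ (Fin N)))
    (d : EuclideanSpace ℝ (Fin N) → ℝ) (c : EuclideanSpace ℝ (Fin N)) :
    EuclideanSpace ℝ (Fin N) :=
  reciprocalMap C (thickDomain C d) (radialMap C d c)

/-- The return map of `Ω_d` is defined at `c`: the inward normal of `Ω_d` exists at `Φ_d(c)` and
the inward normal ray from `Φ_d(c)` meets `C`. -/
def ReturnDefinedAt {N : ℕ} (C : Set (EuclideanSpace ℝ (Fin N)))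
    (d : EuclideanSpace ℝ (Fin N) → ℝ) (c : EuclideanSpace ℝ (Fin N)) : Prop :=
  ∃ n, IsInwardUnitNormal (thickDomain C d) (radialMap C d c) n ∧
    ∃ t : ℝ, 0 ≤ t ∧ radialMap C d c + t • n ∈ C

/-- The leading-order displacement `d(c) ∇_{∂C} d(c)` of the return map. -/
def leadingDisplacement {N : ℕ} (C : Set (EuclideanSpace ℝ (Fin N)))
    (d : EuclideanSpace ℝ (Fin N) → ℝ) (c : EuclideanSpace ℝ (Fin N)) :
    EuclideanSpace ℝ (Fin N) :=
  d c • surfaceGradient C d c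

end

open Filter Topology Set

variable {N : ℕ} {C : Set (EuclideanSpace ℝ (Fin N))}

/-! Compactness of `∂C` upgrades the `C²` regularity to an interior ball condition with one radius
`R` (`IsConvexCore.exists_tangentBall_subset`). With convexity this makes the Gauss map cocoercive
(`InteriorBall.le_inner_sub`), so the shape operator satisfies `R‖Sv‖² ≤ ⟪Sv, v⟫`: it is monotone
and `‖S‖ ≤ 1/R`.

Write `a = d(c)`, `g = ∇d(c)`. Off `C`, the domain is the set where the distance to `C` is less than
`d` at the nearest point. Linearizing this inequality at `Φ_d(c)` gives an inward normal
proportional to `w - ν`, where `(1 + aS*)w = g` (`InteriorBall.isInwardUnitNormal`). The bounds on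
`S` give `‖w‖ ≤ ‖g‖` and `‖w - g‖ ≤ (a/R)‖g‖`.

If the ray `c + aν + s(w - ν)` first meets `C` at `s`, then `s - a` is the depth of the hit below
the tangent hyperplane, and the interior ball bounds it by a multiple of `a²‖w‖`. The expansion
follows from `F - c - ag = (s - a)(w - ν) + a(w - g)`. The line field and the speed come from `∇(λd)
= λ∇d`.

If `λ > 1` and the two return points coincide, their normal and tangential components give `s' = s +
(λ - 1)a` and `s'w' = sw`. Eliminating `w'` and pairing with `w` leaves a sum of nonnegative terms
equal to zero, one of them a positive multiple of `‖w‖²`; hence `w = 0` and `g = 0`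
(`IsFirstHit.eq_zero_of_eq`). The case `λ < 1` exchanges the two thicknesses. -/

/-! ### Local defining functions and the outward normal. -/

theorem HasGradientAt.eventually_lt {E : Type*} [NormedAddCommGroup E] [InnerProductSpace ℝ E]
    [CompleteSpace E] {f : E → ℝ} {g c e : E} (h : HasGradientAt f g c) (he : ⟪g, e⟫ < 0) :
    ∀ᶠ t : ℝ in 𝓝[>] 0, f (c + t • e) < f c := by
  rw [hasGradientAt_iff_isLittleO] at h
  -- With this tolerance the error uses up at most half of the linear decrease; the `+ 1` covers a
  -- vanishing denominator.
  have hε : 0 < -⟪g, e⟫ / (2 * (‖e‖ + 1)) := by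
    have := norm_nonneg e
    apply div_pos <;> linarith
  have h1 := h.def hε
  have ht : Tendsto (fun t : ℝ => c + t • e) (𝓝[>] 0) (𝓝 c) := by
    have : Tendsto (fun t : ℝ => c + t • e) (𝓝 0) (𝓝 (c + (0 : ℝ) • e)) :=
      (by fun_prop : Continuous fun t : ℝ => c + t • e).tendsto 0
    simp only [zero_smul, add_zero] at this
    exact this.mono_left nhdsWithin_le_nhds
  filter_upwards [ht.eventually h1, self_mem_nhdsWithin] with t h2 ht0
  have ht0 : 0 < t := ht0
  simp only [add_sub_cancel_left, norm_smul, Real.norm_eq_abs, abs_of_pos ht0,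
    real_inner_smul_right] at h2
  have h3 := (abs_le.1 h2).2
  have h4 : -⟪g, e⟫ / (2 * (‖e‖ + 1)) * (t * ‖e‖) ≤ t * (-⟪g, e⟫ / 2) := by
    have hn := norm_nonneg e
    have : -⟪g, e⟫ / (2 * (‖e‖ + 1)) * (t * ‖e‖)
        = t * (-⟪g, e⟫ / 2) * (‖e‖ / (‖e‖ + 1)) := by field_simp
    rw [this]
    apply mul_le_of_le_one_right
    · apply mul_nonneg ht0.le; linarith
    · rw [div_le_one] <;> linarith
  nlinarith

/-- At a regular boundary point the outward unit normal of a convex sublevel set is the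
normalized gradient. -/
theorem isOutwardUnitNormal_iff (hconv : Convex ℝ C) {ρ : EuclideanSpace ℝ (Fin N) → ℝ}
    {g c v : EuclideanSpace ℝ (Fin N)} (hρ : HasGradientAt ρ g c) (hg : g ≠ 0) (h0 : ρ c = 0)
    (hc : c ∈ C) (hloc : ∀ᶠ y in 𝓝 c, (y ∈ C ↔ ρ y ≤ 0)) :
    IsOutwardUnitNormal C c v ↔ v = ‖g‖⁻¹ • g := by
  have hgn : 0 < ‖g‖ := norm_pos_iff.2 hg
  have hloc' : ∀ e : EuclideanSpace ℝ (Fin N),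
      ∀ᶠ t : ℝ in 𝓝[>] 0, (c + t • e ∈ C ↔ ρ (c + t • e) ≤ 0) := by
    intro e
    have : Tendsto (fun t : ℝ => c + t • e) (𝓝 0) (𝓝 (c + (0 : ℝ) • e)) :=
      (by fun_prop : Continuous fun t : ℝ => c + t • e).tendsto 0
    simp only [zero_smul, add_zero] at this
    exact (this.mono_left nhdsWithin_le_nhds).eventually hloc
  have hn1 : ‖‖g‖⁻¹ • g‖ = 1 := by
    rw [norm_smul, norm_inv, norm_norm, inv_mul_cancel₀ hgn.ne']
  constructor
  · rintro ⟨hv1, hv⟩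
    by_contra hne
    have hk : ⟪v, ‖g‖⁻¹ • g⟫ < 1 :=
      (inner_lt_one_iff_real_of_norm_eq_one hv1 hn1).2 hne
    -- The direction `v - g/‖g‖` decreases `ρ`, so it enters `C`, yet it has positive inner product
    -- with `v`.
    have hng : ⟪g, v - ‖g‖⁻¹ • g⟫ < 0 := by
      rw [inner_sub_right, real_inner_smul_right, real_inner_self_eq_norm_sq, sub_neg,
        real_inner_comm]
      rw [real_inner_smul_right] at hk
      have : ‖g‖ * (‖g‖⁻¹ * ⟪v, g⟫) < ‖g‖ * 1 := mul_lt_mul_of_pos_left hk hgn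
      rw [mul_inv_cancel_left₀ hgn.ne'] at this
      rw [pow_two, inv_mul_cancel_left₀ hgn.ne']
      linarith
    obtain ⟨t, ht1, ht2, ht3⟩ := ((hρ.eventually_lt hng).and
      ((hloc' _).and self_mem_nhdsWithin)).exists
    have ht3 : 0 < t := ht3
    have hy := hv _ (ht2.2 (by linarith))
    rw [add_sub_cancel_left, real_inner_smul_right, inner_sub_right, real_inner_self_eq_norm_sq,
      hv1] at hy
    nlinarith
  · rintro rfl
    refine ⟨hn1, fun y hy => ?_⟩
    by_contra hpos
    push Not at hpos
    have hρ' : HasGradientAt (fun x => - ρ x) (-g) c := by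
      rw [hasGradientAt_iff_hasFDerivAt] at hρ ⊢
      rw [map_neg]
      exact hρ.neg
    -- Otherwise `ρ` becomes positive on the segment from `c` to `y`, which convexity keeps inside
    -- `C`.
    have hng : ⟪-g, y - c⟫ < 0 := by
      rw [inner_neg_left, neg_lt_zero]
      rw [real_inner_smul_left] at hpos
      exact pos_of_mul_pos_right hpos (by positivity)
    obtain ⟨t, ht1, ht2, ht3, ht4⟩ := ((hρ'.eventually_lt hng).and
      ((hloc' _).and (Ioo_mem_nhdsGT (zero_lt_one (α := ℝ))))).exists
    have := ht2.1 (hconv.add_smul_sub_mem hc hy ⟨ht3.le, ht4.le⟩)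
    linarith

/-- The constants `m` and `L` fix the size of an interior ball near `c₀`; differentiability of `G`
at `c₀` later yields the shape operator. -/
theorem HasC2Boundary.exists_local_gradient (h : HasC2Boundary C)
    {c₀ : EuclideanSpace ℝ (Fin N)} (hc₀ : c₀ ∈ frontier C) :
    ∃ (ρ : EuclideanSpace ℝ (Fin N) → ℝ) (G : EuclideanSpace ℝ (Fin N) → EuclideanSpace ℝ (Fin N))
      (r m L : ℝ), 0 < r ∧ 0 < m ∧ 0 < L ∧ DifferentiableAt ℝ G c₀ ∧
      (∀ x ∈ Metric.ball c₀ r, HasGradientAt ρ (G x) x) ∧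
      (∀ x ∈ Metric.ball c₀ r, m ≤ ‖G x‖) ∧
      (∀ x ∈ Metric.ball c₀ r, ∀ y ∈ Metric.ball c₀ r, ‖G x - G y‖ ≤ L * ‖x - y‖) ∧
      (∀ x ∈ Metric.ball c₀ r, (x ∈ C ↔ ρ x ≤ 0)) := by
  obtain ⟨U, ρ, hU, hcU, hρ, hne, hiff⟩ := h c₀ hc₀
  have hf1 : ContDiffAt ℝ 1 (fderiv ℝ ρ) c₀ :=
    (hρ.fderiv_of_isOpen hU (by norm_num [one_add_one_eq_two])).contDiffAt (hU.mem_nhds hcU)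
  obtain ⟨L, s, hs, hL⟩ := hf1.exists_lipschitzOnWith
  have hpos : 0 < ‖fderiv ℝ ρ c₀‖ := norm_pos_iff.2 hne
  have hev : ∀ᶠ x in 𝓝 c₀, ‖fderiv ℝ ρ c₀‖ / 2 < ‖fderiv ℝ ρ x‖ :=
    hf1.continuousAt.norm.eventually (lt_mem_nhds (half_lt_self hpos))
  obtain ⟨r, hr, hsub⟩ := Metric.mem_nhds_iff.1 (inter_mem (inter_mem hs hev) (hU.mem_nhds hcU))
  refine ⟨ρ, fun x => (InnerProductSpace.toDual ℝ _).symm (fderiv ℝ ρ x), r,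
    ‖fderiv ℝ ρ c₀‖ / 2, L + 1, hr, by positivity, by positivity, ?_, ?_, ?_, ?_, ?_⟩
  · exact ((InnerProductSpace.toDual ℝ
      (EuclideanSpace ℝ (Fin N))).symm.toContinuousLinearEquiv.toContinuousLinearMap
        |>.differentiableAt).comp c₀ (hf1.differentiableAt (by norm_num))
  · intro x hx
    rw [hasGradientAt_iff_hasFDerivAt, LinearIsometryEquiv.apply_symm_apply]
    exact ((hρ.contDiffAt (hU.mem_nhds (hsub hx).2)).differentiableAt (by norm_num)).hasFDerivAt
  · intro x hx
    rw [LinearIsometryEquiv.norm_map]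
    exact (hsub hx).1.2.le
  · intro x hx y hy
    rw [← map_sub, LinearIsometryEquiv.norm_map]
    have := hL.dist_le_mul x (hsub hx).1.1 y (hsub hy).1.1
    rw [dist_eq_norm, dist_eq_norm] at this
    nlinarith [norm_nonneg (x - y)]
  · exact fun x hx => hiff x (hsub hx).2

theorem eq_zero_of_mem_frontier (hcl : IsClosed C) {ρ : EuclideanSpace ℝ (Fin N) → ℝ}
    {c : EuclideanSpace ℝ (Fin N)} (hc : c ∈ frontier C) (hρ : ContinuousAt ρ c)
    (hloc : ∀ᶠ y in 𝓝 c, (y ∈ C ↔ ρ y ≤ 0)) : ρ c = 0 := by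
  rw [hcl.frontier_eq] at hc
  refine le_antisymm (hloc.self_of_nhds.1 hc.1) (not_lt.1 fun hlt => hc.2 ?_)
  rw [mem_interior_iff_mem_nhds]
  filter_upwards [hloc, hρ.eventually (gt_mem_nhds hlt)] with y h1 h2 using h1.2 h2.le

theorem IsConvexCore.isOutwardUnitNormal_iff_of_ball (hC : IsConvexCore C)
    {ρ : EuclideanSpace ℝ (Fin N) → ℝ} {G : EuclideanSpace ℝ (Fin N) → EuclideanSpace ℝ (Fin N)}
    {c₀ : EuclideanSpace ℝ (Fin N)} {r m : ℝ} (hm : 0 < m)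
    (hG : ∀ x ∈ Metric.ball c₀ r, HasGradientAt ρ (G x) x)
    (hm' : ∀ x ∈ Metric.ball c₀ r, m ≤ ‖G x‖)
    (hiff : ∀ x ∈ Metric.ball c₀ r, (x ∈ C ↔ ρ x ≤ 0)) {c v : EuclideanSpace ℝ (Fin N)}
    (hc : c ∈ frontier C) (hcr : c ∈ Metric.ball c₀ r) :
    IsOutwardUnitNormal C c v ↔ v = ‖G c‖⁻¹ • G c := by
  have hloc : ∀ᶠ y in 𝓝 c, (y ∈ C ↔ ρ y ≤ 0) := by
    filter_upwards [Metric.isOpen_ball.mem_nhds hcr] with y hy using hiff y hy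
  exact isOutwardUnitNormal_iff hC.convex (hG c hcr)
    (norm_pos_iff.1 (hm.trans_le (hm' c hcr)))
    (eq_zero_of_mem_frontier hC.isCompact.isClosed hc
      (hG c hcr).hasFDerivAt.continuousAt hloc)
    (hC.isCompact.isClosed.frontier_subset hc) hloc

theorem IsConvexCore.isOutwardUnitNormal (hC : IsConvexCore C) {c : EuclideanSpace ℝ (Fin N)}
    (hc : c ∈ frontier C) : IsOutwardUnitNormal C c (outwardNormal C c) := by
  obtain ⟨ρ, G, r, m, L, hr, hm, -, -, hG, hm', -, hiff⟩ := hC.boundary.exists_local_gradient hc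
  exact Classical.epsilon_spec (p := IsOutwardUnitNormal C c)
    ⟨_, (hC.isOutwardUnitNormal_iff_of_ball hm hG hm' hiff hc (Metric.mem_ball_self hr)).2 rfl⟩

theorem IsConvexCore.eq_outwardNormal (hC : IsConvexCore C) {c v : EuclideanSpace ℝ (Fin N)}
    (hc : c ∈ frontier C) (hv : IsOutwardUnitNormal C c v) : v = outwardNormal C c := by
  obtain ⟨ρ, G, r, m, L, hr, hm, -, -, hG, hm', -, hiff⟩ := hC.boundary.exists_local_gradient hc
  have key := fun u => hC.isOutwardUnitNormal_iff_of_ball (v := u) hm hG hm' hiff hc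
    (Metric.mem_ball_self hr)
  rw [(key v).1 hv, (key _).1 (hC.isOutwardUnitNormal hc)]

theorem IsConvexCore.norm_outwardNormal (hC : IsConvexCore C) {c : EuclideanSpace ℝ (Fin N)}
    (hc : c ∈ frontier C) : ‖outwardNormal C c‖ = 1 := (hC.isOutwardUnitNormal hc).1

theorem IsConvexCore.inner_outwardNormal_le (hC : IsConvexCore C)
    {c y : EuclideanSpace ℝ (Fin N)} (hc : c ∈ frontier C) (hy : y ∈ C) :
    ⟪outwardNormal C c, y - c⟫ ≤ 0 := (hC.isOutwardUnitNormal hc).2 y hy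

/-! ### The uniform interior ball condition. -/

/-- The closed ball of radius `R` that touches the hyperplane `⟪v, · - c⟫ = 0` at `c` from
inside. -/
def tangentBall (c v : EuclideanSpace ℝ (Fin N)) (R : ℝ) : Set (EuclideanSpace ℝ (Fin N)) :=
  {x | ‖x - c‖ ^ 2 ≤ -(2 * R * ⟪v, x - c⟫)}

theorem tangentBall_mono {c v : EuclideanSpace ℝ (Fin N)} {R R' : ℝ} (hR : 0 < R) (h : R ≤ R') :
    tangentBall c v R ⊆ tangentBall c v R' := by
  intro x hx
  have hx : ‖x - c‖ ^ 2 ≤ -(2 * R * ⟪v, x - c⟫) := hx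
  have : ⟪v, x - c⟫ ≤ 0 := by
    by_contra hpos
    push Not at hpos
    have := mul_pos hR hpos
    nlinarith [sq_nonneg ‖x - c‖]
  change ‖x - c‖ ^ 2 ≤ -(2 * R' * ⟪v, x - c⟫)
  nlinarith

/-- Near each boundary point the interior ball condition holds with a uniform radius. -/
theorem IsConvexCore.exists_local_tangentBall_subset (hC : IsConvexCore C)
    {c₀ : EuclideanSpace ℝ (Fin N)} (hc₀ : c₀ ∈ frontier C) :
    ∃ t ∈ 𝓝[frontier C] c₀, ∃ R : ℝ, 0 < R ∧
      ∀ c ∈ t, c ∈ frontier C → tangentBall c (outwardNormal C c) R ⊆ C := by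
  obtain ⟨ρ, G, r, m, L, hr, hm, hL, -, hG, hm', hLip, hiff⟩ :=
    hC.boundary.exists_local_gradient hc₀
  refine ⟨Metric.ball c₀ (r / 2), mem_nhdsWithin_of_mem_nhds (Metric.ball_mem_nhds _ (by positivity)),
    min (r / 8) (m / (2 * L)), by positivity, fun c hcb hc x hx => ?_⟩
  -- The bound `r / 8` keeps the tangent ball, of diameter `2R`, where `ρ` is controlled; `m / (2L)`
  -- lets the linear term of `ρ` absorb its quadratic error.
  set R := min (r / 8) (m / (2 * L)) with hRdef
  have hR0 : 0 < R := by positivity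
  have hR1 : R ≤ r / 8 := min_le_left _ _
  have hR2 : R ≤ m / (2 * L) := min_le_right _ _
  have hcb' : c ∈ Metric.ball c₀ r := Metric.ball_subset_ball (by linarith) hcb
  have hν := (hC.isOutwardUnitNormal_iff_of_ball hm hG hm' hiff hc hcb').1
    (hC.isOutwardUnitNormal hc)
  have hν1 := hC.norm_outwardNormal hc
  set ν := outwardNormal C c
  have hx : ‖x - c‖ ^ 2 ≤ -(2 * R * ⟪ν, x - c⟫) := hx
  have hxc : ‖x - c‖ ≤ 2 * R := by
    have h1 := (abs_le.1 (abs_real_inner_le_norm ν (x - c))).1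
    rw [hν1, one_mul] at h1
    by_contra hlt
    push Not at hlt
    nlinarith [norm_nonneg (x - c)]
  have hball : Metric.closedBall c ‖x - c‖ ⊆ Metric.ball c₀ r := by
    intro z hz
    rw [Metric.mem_closedBall] at hz
    rw [Metric.mem_ball] at hcb ⊢
    linarith [dist_triangle z c c₀]
  -- The gradient varies by at most `L‖x - c‖` on this ball, so the mean value inequality bounds the
  -- Taylor remainder by `L‖x - c‖²`.
  have htay := (convex_closedBall c ‖x - c‖).norm_image_sub_le_of_norm_hasFDerivWithin_le'
    (f := ρ) (C := L * ‖x - c‖) (φ := InnerProductSpace.toDual ℝ _ (G c))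
    (f' := fun z => InnerProductSpace.toDual ℝ _ (G z)) (x := c) (y := x)
    (fun z hz => ((hG z (hball hz)).hasFDerivAt).hasFDerivWithinAt)
    (fun z hz => by
      rw [← map_sub, LinearIsometryEquiv.norm_map]
      rw [Metric.mem_closedBall, dist_eq_norm] at hz
      exact (hLip z (hball hz) c hcb').trans (by gcongr))
    (Metric.mem_closedBall_self (norm_nonneg _))
    (by rw [Metric.mem_closedBall, dist_eq_norm])
  have hloc : ∀ᶠ y in 𝓝 c, (y ∈ C ↔ ρ y ≤ 0) := by
    filter_upwards [Metric.isOpen_ball.mem_nhds hcb'] with y hy using hiff y hy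
  rw [eq_zero_of_mem_frontier hC.isCompact.isClosed hc
      (hG c hcb').hasFDerivAt.continuousAt hloc, InnerProductSpace.toDual_apply_apply, sub_zero] at htay
  have hGm := hm' c hcb'
  have hGν : ⟪G c, x - c⟫ = ‖G c‖ * ⟪ν, x - c⟫ := by
    rw [hν, real_inner_smul_left, mul_inv_cancel_left₀ (hm.trans_le hGm).ne']
  refine (hiff x (hball (by rw [Metric.mem_closedBall, dist_eq_norm]))).2 ?_
  have h2 := (abs_le.1 htay).2
  rw [hGν] at h2
  have hin : ⟪ν, x - c⟫ ≤ 0 := by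
    by_contra hpos
    push Not at hpos
    nlinarith [sq_nonneg ‖x - c‖, mul_pos hR0 hpos]
  have h3 : ‖G c‖ * ⟪ν, x - c⟫ ≤ m * ⟪ν, x - c⟫ := mul_le_mul_of_nonpos_right hGm hin
  have h4 : R * (2 * L) ≤ m := (le_div_iff₀ (by positivity)).1 hR2
  have h5 : L * ‖x - c‖ ^ 2 ≤ L * -(2 * R * ⟪ν, x - c⟫) := mul_le_mul_of_nonneg_left hx hL.le
  nlinarith

/-- Compactness induction over `∂C`: tangent balls at a point are nested, so two local radii can be
replaced by their minimum. -/
theorem IsConvexCore.exists_tangentBall_subset (hC : IsConvexCore C) :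
    ∃ R : ℝ, 0 < R ∧ ∀ c ∈ frontier C, tangentBall c (outwardNormal C c) R ⊆ C := by
  have hcomp : IsCompact (frontier C) :=
    hC.isCompact.of_isClosed_subset isClosed_frontier hC.isCompact.isClosed.frontier_subset
  have := hcomp.induction_on (p := fun s => ∃ R : ℝ, 0 < R ∧
      ∀ c ∈ s, c ∈ frontier C → tangentBall c (outwardNormal C c) R ⊆ C)
    ⟨1, one_pos, by simp⟩
    (fun s t hst ⟨R, hR, h⟩ => ⟨R, hR, fun c hc => h c (hst hc)⟩)
    (by
      rintro s t ⟨R, hR, h⟩ ⟨R', hR', h'⟩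
      refine ⟨min R R', lt_min hR hR', fun c hc hcf => ?_⟩
      rcases hc with hc | hc
      · exact (tangentBall_mono (lt_min hR hR') (min_le_left _ _)).trans (h c hc hcf)
      · exact (tangentBall_mono (lt_min hR hR') (min_le_right _ _)).trans (h' c hc hcf))
    (fun c hc => hC.exists_local_tangentBall_subset hc)
  obtain ⟨R, hR, h⟩ := this
  exact ⟨R, hR, fun c hc => h c hc hc⟩

/-! ### Nearest points and normal coordinates. -/

/-- The nearest point to `x` in a closed convex set. -/
noncomputable def nearestPoint (C : Set (EuclideanSpace ℝ (Fin N)))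
    (x : EuclideanSpace ℝ (Fin N)) : EuclideanSpace ℝ (Fin N) :=
  Classical.epsilon fun y => y ∈ C ∧ ∀ z ∈ C, ⟪x - y, z - y⟫ ≤ 0

theorem IsConvexCore.nearestPoint_spec (hC : IsConvexCore C) (x : EuclideanSpace ℝ (Fin N)) :
    nearestPoint C x ∈ C ∧ ∀ z ∈ C, ⟪x - nearestPoint C x, z - nearestPoint C x⟫ ≤ 0 := by
  obtain ⟨y, hy, h⟩ := exists_norm_eq_iInf_of_complete_convex
    (hC.interior_nonempty.mono interior_subset) hC.isCompact.isComplete hC.convex x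
  exact Classical.epsilon_spec (p := fun y => y ∈ C ∧ ∀ z ∈ C, ⟪x - y, z - y⟫ ≤ 0)
    ⟨y, hy, (norm_eq_iInf_iff_real_inner_le_zero hC.convex hy).1 h⟩

theorem IsConvexCore.nearestPoint_mem (hC : IsConvexCore C) (x : EuclideanSpace ℝ (Fin N)) :
    nearestPoint C x ∈ C := (hC.nearestPoint_spec x).1

/-- Adding the two variational inequalities and applying Cauchy–Schwarz gives both the Lipschitz
bound for nearest points and, with `x = x'`, their uniqueness. -/
theorem norm_sub_le_of_inner_le_zero {x x' y y' : EuclideanSpace ℝ (Fin N)}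
    (h : ⟪x - y, y' - y⟫ ≤ 0) (h' : ⟪x' - y', y - y'⟫ ≤ 0) : ‖y - y'‖ ≤ ‖x - x'‖ := by
  have h1 : ‖y - y'‖ ^ 2 ≤ ⟪x - x', y - y'⟫ := by
    have e1 : ⟪x - y, y' - y⟫ = -⟪x - y, y - y'⟫ := by rw [← inner_neg_right, neg_sub]
    have e2 : x - x' = (x - y) - (x' - y') + (y - y') := by abel
    rw [e2, inner_add_left, inner_sub_left, real_inner_self_eq_norm_sq]
    linarith
  have h2 := real_inner_le_norm (x - x') (y - y')
  by_contra hlt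
  push Not at hlt
  nlinarith [norm_nonneg (x - x'), norm_nonneg (y - y')]

theorem IsConvexCore.norm_nearestPoint_sub_le (hC : IsConvexCore C)
    (x x' : EuclideanSpace ℝ (Fin N)) :
    ‖nearestPoint C x - nearestPoint C x'‖ ≤ ‖x - x'‖ :=
  norm_sub_le_of_inner_le_zero ((hC.nearestPoint_spec x).2 _ (hC.nearestPoint_mem x'))
    ((hC.nearestPoint_spec x').2 _ (hC.nearestPoint_mem x))

theorem IsConvexCore.nearestPoint_eq (hC : IsConvexCore C) {x y : EuclideanSpace ℝ (Fin N)}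
    (hy : y ∈ C) (h : ∀ z ∈ C, ⟪x - y, z - y⟫ ≤ 0) : nearestPoint C x = y := by
  have := norm_sub_le_of_inner_le_zero ((hC.nearestPoint_spec x).2 _ hy)
    (h _ (hC.nearestPoint_mem x))
  rw [sub_self, norm_zero] at this
  exact sub_eq_zero.1 (norm_le_zero_iff.1 this)

theorem IsConvexCore.nearestPoint_add_smul (hC : IsConvexCore C)
    {c : EuclideanSpace ℝ (Fin N)} (hc : c ∈ frontier C) {r : ℝ} (hr : 0 ≤ r) :
    nearestPoint C (c + r • outwardNormal C c) = c := by
  refine hC.nearestPoint_eq (hC.isCompact.isClosed.frontier_subset hc) fun z hz => ?_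
  rw [add_sub_cancel_left, real_inner_smul_left]
  exact mul_nonpos_of_nonneg_of_nonpos hr (hC.inner_outwardNormal_le hc hz)

theorem IsConvexCore.norm_sub_nearestPoint_le (hC : IsConvexCore C)
    {x z : EuclideanSpace ℝ (Fin N)} (hz : z ∈ C) :
    ‖x - nearestPoint C x‖ ≤ ‖x - z‖ := by
  have h := (hC.nearestPoint_spec x).2 z hz
  have e : x - z = (x - nearestPoint C x) - (z - nearestPoint C x) := by abel
  have h2 := norm_sub_sq_real (x - nearestPoint C x) (z - nearestPoint C x)
  rw [← e] at h2
  by_contra hlt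
  push Not at hlt
  nlinarith [norm_nonneg (x - z), sq_nonneg ‖z - nearestPoint C x‖]

/-- From an interior point one could still move towards `x`. Excluding only the interior matters:
tangent lines may touch `C`. -/
theorem IsConvexCore.nearestPoint_mem_frontier (hC : IsConvexCore C)
    {x : EuclideanSpace ℝ (Fin N)} (hx : x ∉ interior C) : nearestPoint C x ∈ frontier C := by
  rw [hC.isCompact.isClosed.frontier_eq]
  refine ⟨hC.nearestPoint_mem x, fun hint => ?_⟩
  by_cases hxe : nearestPoint C x = x
  · exact hx (hxe ▸ hint)
  have hcont : Tendsto (fun t : ℝ => nearestPoint C x + t • (x - nearestPoint C x)) (𝓝[>] 0)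
      (𝓝 (nearestPoint C x)) := by
    have : Tendsto (fun t : ℝ => nearestPoint C x + t • (x - nearestPoint C x)) (𝓝 0)
      (𝓝 (nearestPoint C x + (0 : ℝ) • (x - nearestPoint C x))) :=
      (by fun_prop : Continuous fun t : ℝ =>
        nearestPoint C x + t • (x - nearestPoint C x)).tendsto 0
    simp only [zero_smul, add_zero] at this
    exact this.mono_left nhdsWithin_le_nhds
  obtain ⟨t, ht, ht0⟩ := ((hcont.eventually (mem_interior_iff_mem_nhds.1 hint)).and
    self_mem_nhdsWithin).exists
  have ht0 : 0 < t := ht0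
  have := (hC.nearestPoint_spec x).2 _ ht
  rw [add_sub_cancel_left, real_inner_smul_right, real_inner_self_eq_norm_sq] at this
  have hpos : 0 < ‖x - nearestPoint C x‖ := norm_pos_iff.2 (sub_ne_zero.2 (Ne.symm hxe))
  have := mul_pos ht0 (pow_pos hpos 2)
  linarith

/-- Together with `nearestPoint_add_smul`, this makes nearest point and distance the inverse of the
coordinates `c + rν(c)` off `C`. -/
theorem IsConvexCore.sub_nearestPoint (hC : IsConvexCore C) {x : EuclideanSpace ℝ (Fin N)}
    (hx : x ∉ C) : x - nearestPoint C x
      = ‖x - nearestPoint C x‖ • outwardNormal C (nearestPoint C x) := by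
  have hne : x - nearestPoint C x ≠ 0 := fun h =>
    hx (by rw [sub_eq_zero.1 h]; exact hC.nearestPoint_mem x)
  have hpos := norm_pos_iff.2 hne
  have hn : ‖x - nearestPoint C x‖⁻¹ • (x - nearestPoint C x)
      = outwardNormal C (nearestPoint C x) := by
    refine hC.eq_outwardNormal (hC.nearestPoint_mem_frontier fun h => hx (interior_subset h))
      ⟨?_, fun y hy => ?_⟩
    · rw [norm_smul, norm_inv, norm_norm, inv_mul_cancel₀ hpos.ne']
    · rw [real_inner_smul_left]
      exact mul_nonpos_of_nonneg_of_nonpos (by positivity) ((hC.nearestPoint_spec x).2 y hy)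
  rw [← hn, smul_inv_smul₀ hpos.ne']

/-! ### Regularity of the Gauss map. -/

/-- The interior ball condition of radius `R`. -/
def InteriorBall (C : Set (EuclideanSpace ℝ (Fin N))) (R : ℝ) : Prop :=
  ∀ c ∈ frontier C, tangentBall c (outwardNormal C c) R ⊆ C

theorem isLittleO_norm_sub_sq (c : EuclideanSpace ℝ (Fin N)) :
    (fun y => ‖y - c‖ ^ 2) =o[𝓝 c] fun y => y - c := by
  have h3 : Tendsto (fun y => ‖y - c‖) (𝓝 c) (𝓝 0) := by
    have := (by fun_prop : Continuous fun y => ‖y - c‖).tendsto c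
    rwa [sub_self, norm_zero] at this
  exact ((Asymptotics.isLittleO_pow_id one_lt_two).comp_tendsto h3).trans_isBigO
    (Asymptotics.isBigO_refl _ _).norm_left

/-- The point `c + R(μ - ν)` is the extreme point, in direction `μ`, of the tangent ball at `c`; it
lies in `C`, hence in the supporting half-space at `y`. -/
theorem InteriorBall.le_inner (hC : IsConvexCore C) {R : ℝ} (hR : 0 < R)
    (hB : InteriorBall C R) {c y : EuclideanSpace ℝ (Fin N)} (hc : c ∈ frontier C)
    (hy : y ∈ frontier C) :
    R / 2 * ‖outwardNormal C y - outwardNormal C c‖ ^ 2 ≤ ⟪outwardNormal C y, y - c⟫ := by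
  have h1 := hC.norm_outwardNormal hc
  have h2 := hC.norm_outwardNormal hy
  set ν := outwardNormal C c
  set μ := outwardNormal C y
  have hmem : c + R • (μ - ν) ∈ C := by
    refine hB c hc ?_
    change ‖c + R • (μ - ν) - c‖ ^ 2 ≤ -(2 * R * ⟪ν, c + R • (μ - ν) - c⟫)
    rw [add_sub_cancel_left, norm_smul, Real.norm_of_nonneg hR.le, mul_pow,
      norm_sub_sq_real, real_inner_smul_right, inner_sub_right, real_inner_self_eq_norm_sq, h1, h2,
      real_inner_comm ν μ]
    nlinarith
  have h3 := hC.inner_outwardNormal_le hy hmem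
  have e : c + R • (μ - ν) - y = R • (μ - ν) - (y - c) := by abel
  change ⟪μ, c + R • (μ - ν) - y⟫ ≤ 0 at h3
  rw [e, inner_sub_right, real_inner_smul_right, inner_sub_right, real_inner_self_eq_norm_sq,
    h2] at h3
  rw [norm_sub_sq_real, h1, h2]
  nlinarith

/-- The Gauss map of a convex core with an interior ball condition is cocoercive. -/
theorem InteriorBall.le_inner_sub (hC : IsConvexCore C) {R : ℝ} (hR : 0 < R)
    (hB : InteriorBall C R) {c y : EuclideanSpace ℝ (Fin N)} (hc : c ∈ frontier C)
    (hy : y ∈ frontier C) :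
    R * ‖outwardNormal C y - outwardNormal C c‖ ^ 2
      ≤ ⟪outwardNormal C y - outwardNormal C c, y - c⟫ := by
  have h1 := hB.le_inner hC hR hc hy
  have h2 := hB.le_inner hC hR hy hc
  rw [norm_sub_rev, ← neg_sub y c, inner_neg_right] at h2
  rw [inner_sub_left]
  linarith

theorem InteriorBall.norm_outwardNormal_sub_le (hC : IsConvexCore C) {R : ℝ} (hR : 0 < R)
    (hB : InteriorBall C R) {c y : EuclideanSpace ℝ (Fin N)} (hc : c ∈ frontier C)
    (hy : y ∈ frontier C) :
    ‖outwardNormal C y - outwardNormal C c‖ ≤ R⁻¹ * ‖y - c‖ := by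
  have h1 := (hB.le_inner_sub hC hR hc hy).trans (real_inner_le_norm _ _)
  rw [inv_mul_eq_div, le_div_iff₀ hR]
  by_contra hlt
  push Not at hlt
  have h0 := norm_nonneg (y - c)
  have hpos : 0 < ‖outwardNormal C y - outwardNormal C c‖ := by
    by_contra hle
    have := le_antisymm (not_lt.1 hle) (norm_nonneg _)
    rw [this] at hlt
    linarith
  nlinarith [mul_lt_mul_of_pos_left hlt hpos]

/-- The boundary is quadratically close to its tangent hyperplane. -/
theorem InteriorBall.abs_inner_sub_le (hC : IsConvexCore C) {R : ℝ} (hR : 0 < R)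
    (hB : InteriorBall C R) {c y : EuclideanSpace ℝ (Fin N)} (hc : c ∈ frontier C)
    (hy : y ∈ frontier C) :
    |⟪outwardNormal C c, y - c⟫| ≤ R⁻¹ * ‖y - c‖ ^ 2 := by
  have h1 := hC.inner_outwardNormal_le hc (hC.isCompact.isClosed.frontier_subset hy)
  have h2 := hB.le_inner hC hR hc hy
  have h3 := real_inner_le_norm (outwardNormal C y - outwardNormal C c) (y - c)
  have h4 := mul_le_mul_of_nonneg_right (hB.norm_outwardNormal_sub_le hC hR hc hy)
    (norm_nonneg (y - c))
  rw [inner_sub_left] at h3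
  have : 0 ≤ R / 2 * ‖outwardNormal C y - outwardNormal C c‖ ^ 2 := by positivity
  rw [abs_of_nonpos h1]
  nlinarith

theorem InteriorBall.isLittleO_inner (hC : IsConvexCore C) {R : ℝ} (hR : 0 < R)
    (hB : InteriorBall C R) {c : EuclideanSpace ℝ (Fin N)} (hc : c ∈ frontier C) :
    (fun y => ⟪outwardNormal C c, y - c⟫) =o[𝓝[frontier C] c] fun y => y - c := by
  have h2 : (fun y => ⟪outwardNormal C c, y - c⟫) =O[𝓝[frontier C] c] fun y => ‖y - c‖ ^ 2 := by
    refine Asymptotics.IsBigO.of_bound R⁻¹ ?_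
    filter_upwards [self_mem_nhdsWithin] with y hy
    have := hB.abs_inner_sub_le hC hR hc hy
    rwa [Real.norm_eq_abs, Real.norm_of_nonneg (by positivity)]
  exact h2.trans_isLittleO ((isLittleO_norm_sub_sq c).mono nhdsWithin_le_nhds)

/-! ### Curves in the boundary and the shape operator. -/

theorem IsConvexCore.add_smul_notMem_interior (hC : IsConvexCore C)
    {c τ : EuclideanSpace ℝ (Fin N)} (hc : c ∈ frontier C)
    (hτ : ⟪outwardNormal C c, τ⟫ = 0) (t : ℝ) : c + t • τ ∉ interior C := by
  intro hint
  have hcont : Tendsto (fun s : ℝ => c + t • τ + s • outwardNormal C c) (𝓝[>] 0)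
      (𝓝 (c + t • τ)) := by
    have : Tendsto (fun s : ℝ => c + t • τ + s • outwardNormal C c) (𝓝 0)
      (𝓝 (c + t • τ + (0 : ℝ) • outwardNormal C c)) :=
      (by fun_prop : Continuous fun s : ℝ => c + t • τ + s • outwardNormal C c).tendsto 0
    simp only [zero_smul, add_zero] at this
    exact this.mono_left nhdsWithin_le_nhds
  obtain ⟨s, hs, hs0⟩ := ((hcont.eventually (mem_interior_iff_mem_nhds.1 hint)).and
    self_mem_nhdsWithin).exists
  have hs0 : 0 < s := hs0
  have := hC.inner_outwardNormal_le hc hs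
  rw [add_assoc, add_sub_cancel_left, inner_add_right, real_inner_smul_right,
    real_inner_smul_right, hτ, real_inner_self_eq_norm_sq, hC.norm_outwardNormal hc] at this
  linarith

/-- Every tangent vector is the velocity of a curve in the boundary. -/
theorem InteriorBall.hasDerivAt_nearestPoint (hC : IsConvexCore C) {R : ℝ} (hR : 0 < R)
    (hB : InteriorBall C R) {c τ : EuclideanSpace ℝ (Fin N)} (hc : c ∈ frontier C)
    (hτ : ⟪outwardNormal C c, τ⟫ = 0) :
    HasDerivAt (fun t : ℝ => nearestPoint C (c + t • τ)) τ 0 := by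
  have h0 : nearestPoint C (c + (0 : ℝ) • τ) = c := by
    simpa using hC.nearestPoint_add_smul hc le_rfl
  rw [hasDerivAt_iff_isLittleO, h0]
  have hO : (fun t : ℝ => nearestPoint C (c + t • τ) - c - (t - 0) • τ)
      =O[𝓝 0] fun t : ℝ => t ^ 2 := by
    refine Asymptotics.IsBigO.of_bound (‖τ‖ ^ 2 / R) ?_
    have hlim : Tendsto (fun t : ℝ => ‖t • τ‖) (𝓝 0) (𝓝 0) := by
      have := (by fun_prop : Continuous fun t : ℝ => ‖t • τ‖).tendsto 0
      simpa only [zero_smul, norm_zero] using this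
    filter_upwards [hlim.eventually (gt_mem_nhds hR)] with t ht
    -- Lowering `c + tτ` by this depth puts it in the tangent ball once `h ≤ R`, so projecting moves
    -- it by only `O(t²)`.
    set h : ℝ := ‖t • τ‖ ^ 2 / R with hh
    have hh0 : 0 ≤ h := by positivity
    have hRh : R * h = ‖t • τ‖ ^ 2 := by rw [hh]; field_simp
    have hhR : h ≤ R := by
      rw [hh, div_le_iff₀ hR]
      nlinarith [norm_nonneg (t • τ)]
    have hmem : c + (t • τ - h • outwardNormal C c) ∈ C := by
      refine hB c hc ?_
      simp only [tangentBall, mem_ofPred_eq, add_sub_cancel_left]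
      rw [norm_sub_sq_real, real_inner_smul_right, inner_sub_right, real_inner_smul_right,
        real_inner_smul_right, real_inner_self_eq_norm_sq, real_inner_comm, real_inner_smul_right,
        hτ, hC.norm_outwardNormal hc, norm_smul h, hC.norm_outwardNormal hc,
        Real.norm_of_nonneg hh0]
      nlinarith
    have h1 := hC.norm_sub_nearestPoint_le (x := c + t • τ) hmem
    have e1 : c + t • τ - (c + (t • τ - h • outwardNormal C c)) = h • outwardNormal C c := by abel
    rw [e1, norm_smul, hC.norm_outwardNormal hc, Real.norm_of_nonneg hh0, mul_one] at h1
    rw [sub_zero, sub_sub, norm_sub_rev]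
    refine h1.trans (le_of_eq ?_)
    rw [hh, norm_smul, mul_pow, Real.norm_eq_abs, sq_abs, Real.norm_eq_abs, abs_pow, sq_abs]
    ring
  refine hO.trans_isLittleO ?_
  simp only [sub_zero]
  exact Asymptotics.isLittleO_pow_id one_lt_two

/-- Projected tangent lines turn derivatives within `∂C` into one-variable derivatives; the
properties of the shape operator and the uniqueness of the surface gradient are tested this way. -/
theorem InteriorBall.hasDerivAt_comp (hC : IsConvexCore C) {R : ℝ} (hR : 0 < R)
    (hB : InteriorBall C R) {c τ : EuclideanSpace ℝ (Fin N)} (hc : c ∈ frontier C)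
    (hτ : ⟪outwardNormal C c, τ⟫ = 0) {F : Type*} [NormedAddCommGroup F] [NormedSpace ℝ F]
    {f : EuclideanSpace ℝ (Fin N) → F} {f' : EuclideanSpace ℝ (Fin N) →L[ℝ] F}
    (hf : HasFDerivWithinAt f f' (frontier C) c) :
    HasDerivAt (fun t : ℝ => f (nearestPoint C (c + t • τ))) (f' τ) 0 := by
  have h0 : nearestPoint C (c + (0 : ℝ) • τ) = c := by
    simpa using hC.nearestPoint_add_smul hc le_rfl
  refine HasFDerivWithinAt.comp_hasDerivAt (t := frontier C) (0 : ℝ) (by rwa [h0])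
    (hB.hasDerivAt_nearestPoint hC hR hc hτ) (Eventually.of_forall fun t => ?_)
  exact hC.nearestPoint_mem_frontier (hC.add_smul_notMem_interior hc hτ t)

theorem IsConvexCore.differentiableWithinAt_outwardNormal (hC : IsConvexCore C)
    {c : EuclideanSpace ℝ (Fin N)} (hc : c ∈ frontier C) :
    DifferentiableWithinAt ℝ (outwardNormal C) (frontier C) c := by
  obtain ⟨ρ, G, r, m, L, hr, hm, -, hGd, hG, hm', -, hiff⟩ := hC.boundary.exists_local_gradient hc
  have hcr : c ∈ Metric.ball c r := Metric.mem_ball_self hr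
  have hne : G c ≠ 0 := norm_pos_iff.1 (hm.trans_le (hm' c hcr))
  have hd : DifferentiableAt ℝ (fun x => ‖G x‖⁻¹ • G x) c :=
    ((hGd.norm ℝ hne).inv (norm_ne_zero_iff.2 hne)).smul hGd
  refine hd.differentiableWithinAt.congr_of_eventuallyEq_of_mem ?_ hc
  filter_upwards [self_mem_nhdsWithin,
    mem_nhdsWithin_of_mem_nhds (Metric.isOpen_ball.mem_nhds hcr)] with y hy hyr
  exact (hC.isOutwardUnitNormal_iff_of_ball hm hG hm' hiff hy hyr).1 (hC.isOutwardUnitNormal hy)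

/-- The shape operator, extended by zero to the normal direction. -/
theorem InteriorBall.exists_shapeOperator (hC : IsConvexCore C) {R : ℝ} (hR : 0 < R)
    (hB : InteriorBall C R) {c : EuclideanSpace ℝ (Fin N)} (hc : c ∈ frontier C) :
    ∃ S : EuclideanSpace ℝ (Fin N) →L[ℝ] EuclideanSpace ℝ (Fin N),
      HasFDerivWithinAt (outwardNormal C) S (frontier C) c ∧ S (outwardNormal C c) = 0 ∧
      ∀ v, R * ‖S v‖ ^ 2 ≤ ⟪S v, v⟫ := by
  have hν1 := hC.norm_outwardNormal hc
  set ν := outwardNormal C c with hν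
  have h0 : nearestPoint C c = c := by
    simpa using hC.nearestPoint_add_smul hc le_rfl
  have hB' := (hC.differentiableWithinAt_outwardNormal hc).hasFDerivWithinAt
  set B := fderivWithin ℝ (outwardNormal C) (frontier C) c
  -- Differentiate `‖outwardNormal‖² = 1` along the curve.
  have hnormal : ∀ τ, ⟪ν, τ⟫ = 0 → ⟪B τ, ν⟫ = 0 := by
    intro τ hτ
    have h1 := (hB.hasDerivAt_comp hC hR hc hτ hB').norm_sq
    have h2 : HasDerivAt (fun t : ℝ => ‖outwardNormal C (nearestPoint C (c + t • τ))‖ ^ 2)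
        0 0 := by
      refine (hasDerivAt_const (0 : ℝ) (1 : ℝ)).congr_of_eventuallyEq (Eventually.of_forall fun t => ?_)
      simp only
      rw [hC.norm_outwardNormal
        (hC.nearestPoint_mem_frontier (hC.add_smul_notMem_interior hc hτ t)), one_pow]
    have h3 := h1.unique h2
    rw [zero_smul, add_zero, h0] at h3
    rw [real_inner_comm]
    linarith
  -- Cocoercivity of the Gauss map passes to the limit of difference quotients.
  have hcoer : ∀ τ, ⟪ν, τ⟫ = 0 → R * ‖B τ‖ ^ 2 ≤ ⟪B τ, τ⟫ := by
    intro τ hτ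
    have h1 := (hasDerivAt_iff_tendsto_slope.1 (hB.hasDerivAt_comp hC hR hc hτ hB'))
    have h2 := (hasDerivAt_iff_tendsto_slope.1 (hB.hasDerivAt_nearestPoint hC hR hc hτ))
    refine le_of_tendsto_of_tendsto' ((h1.norm.pow 2).const_mul R) (h1.inner h2) fun t => ?_
    simp only [slope_def_module, zero_smul, add_zero, h0, sub_zero]
    rw [norm_smul, real_inner_smul_left, real_inner_smul_right, mul_pow, Real.norm_eq_abs, sq_abs]
    have h3 := hB.le_inner_sub hC hR hc
      (hC.nearestPoint_mem_frontier (hC.add_smul_notMem_interior hc hτ t))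
    nlinarith [mul_le_mul_of_nonneg_left h3 (sq_nonneg t⁻¹)]
  -- The chosen derivative is not controlled along `ν`. Composing with the tangential projection
  -- removes this part at a cost `⟪ν, y - c⟫ • B ν`, which is `o(‖y - c‖)` on `∂C`.
  set P : EuclideanSpace ℝ (Fin N) →L[ℝ] EuclideanSpace ℝ (Fin N) :=
    ContinuousLinearMap.id ℝ _ - (innerSL ℝ ν).smulRight ν with hP
  have hPv : ∀ v, P v = v - ⟪ν, v⟫ • ν := fun v => by simp [hP]
  have hPt : ∀ v, ⟪ν, P v⟫ = 0 := fun v => by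
    rw [hPv, inner_sub_right, real_inner_smul_right, real_inner_self_eq_norm_sq, hν1]; ring
  refine ⟨B.comp P, ?_, ?_, fun v => ?_⟩
  · rw [hasFDerivWithinAt_iff_isLittleO] at hB' ⊢
    have h1 : (fun y => ⟪ν, y - c⟫ • B ν) =o[𝓝[frontier C] c] fun y => y - c := by
      refine Asymptotics.IsBigO.trans_isLittleO ?_ (hB.isLittleO_inner hC hR hc)
      refine Asymptotics.IsBigO.of_bound ‖B ν‖ (Eventually.of_forall fun y => ?_)
      rw [norm_smul, mul_comm]
    refine (hB'.add h1).congr_left fun y => ?_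
    rw [ContinuousLinearMap.comp_apply, hPv, map_sub B (y - c), map_smul B]
    abel
  · rw [ContinuousLinearMap.comp_apply, hPv, real_inner_self_eq_norm_sq, hν1]
    simp
  · rw [ContinuousLinearMap.comp_apply]
    have h1 := hcoer _ (hPt v)
    have h2 : ⟪B (P v), v⟫ = ⟪B (P v), P v⟫ := by
      nth_rewrite 3 [hPv]
      rw [inner_sub_right, real_inner_smul_right, hnormal _ (hPt v)]
      ring
    linarith

/-! ### The surface gradient. -/

/-- The normal component of any gradient within `∂C` can be dropped, since `⟪ν, y - c⟫` is
negligible there. -/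
theorem InteriorBall.exists_hasSurfaceGradientAt (hC : IsConvexCore C) {R : ℝ} (hR : 0 < R)
    (hB : InteriorBall C R) {c : EuclideanSpace ℝ (Fin N)} (hc : c ∈ frontier C)
    {d : EuclideanSpace ℝ (Fin N) → ℝ} (hd : DifferentiableWithinAt ℝ d (frontier C) c) :
    ∃ g, HasSurfaceGradientAt C d g c := by
  have h := hd.hasGradientWithinAt
  set g := gradientWithin d (frontier C) c
  set ν := outwardNormal C c with hν
  refine ⟨g - ⟪ν, g⟫ • ν, ?_, ?_⟩
  · rw [inner_sub_left, real_inner_smul_left, ← hν, real_inner_self_eq_norm_sq,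
      hC.norm_outwardNormal hc, real_inner_comm]
    ring
  · rw [hasGradientWithinAt_iff_isLittleO] at h ⊢
    refine (h.add ((hB.isLittleO_inner hC hR hc).const_mul_left ⟪ν, g⟫)).congr_left fun y => ?_
    rw [inner_sub_left, real_inner_smul_left]
    ring

theorem InteriorBall.hasSurfaceGradientAt_unique (hC : IsConvexCore C) {R : ℝ} (hR : 0 < R)
    (hB : InteriorBall C R) {c g g' : EuclideanSpace ℝ (Fin N)} (hc : c ∈ frontier C)
    {d : EuclideanSpace ℝ (Fin N) → ℝ} (h : HasSurfaceGradientAt C d g c)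
    (h' : HasSurfaceGradientAt C d g' c) : g = g' := by
  have hτ : ⟪outwardNormal C c, g - g'⟫ = 0 := by
    rw [real_inner_comm, inner_sub_left, h.1, h'.1, sub_zero]
  have h1 := hB.hasDerivAt_comp hC hR hc hτ h.2.hasFDerivWithinAt
  have h2 := hB.hasDerivAt_comp hC hR hc hτ h'.2.hasFDerivWithinAt
  have h3 := h1.unique h2
  rw [InnerProductSpace.toDual_apply_apply, InnerProductSpace.toDual_apply_apply, ← sub_eq_zero,
    ← inner_sub_left, inner_self_eq_zero] at h3
  exact sub_eq_zero.1 h3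

theorem InteriorBall.hasSurfaceGradientAt (hC : IsConvexCore C) {R : ℝ} (hR : 0 < R)
    (hB : InteriorBall C R) {c : EuclideanSpace ℝ (Fin N)} (hc : c ∈ frontier C)
    {d : EuclideanSpace ℝ (Fin N) → ℝ} (hd : IsThickness C d) :
    HasSurfaceGradientAt C d (surfaceGradient C d c) c :=
  Classical.epsilon_spec (p := fun g => HasSurfaceGradientAt C d g c)
    (hB.exists_hasSurfaceGradientAt hC hR hc (hd.contDiffOn.differentiableOn (by norm_num) c hc))

theorem IsThickness.const_mul {d : EuclideanSpace ℝ (Fin N) → ℝ} (hd : IsThickness C d)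
    {a : ℝ} (ha : 0 < a) : IsThickness C fun x => a * d x :=
  ⟨contDiffOn_const.mul hd.contDiffOn, fun c hc => mul_pos ha (hd.pos c hc)⟩

theorem InteriorBall.surfaceGradient_const_mul (hC : IsConvexCore C) {R : ℝ} (hR : 0 < R)
    (hB : InteriorBall C R) {c : EuclideanSpace ℝ (Fin N)} (hc : c ∈ frontier C)
    {d : EuclideanSpace ℝ (Fin N) → ℝ} (hd : IsThickness C d) {a : ℝ} (ha : 0 < a) :
    surfaceGradient C (fun x => a * d x) c = a • surfaceGradient C d c := by
  have h := hB.hasSurfaceGradientAt hC hR hc hd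
  refine hB.hasSurfaceGradientAt_unique hC hR hc
    (hB.hasSurfaceGradientAt hC hR hc (hd.const_mul ha)) ⟨?_, ?_⟩
  · rw [real_inner_smul_left, h.1, mul_zero]
  · have h2 := h.2
    rw [hasGradientWithinAt_iff_isLittleO] at h2 ⊢
    refine (h2.const_mul_left a).congr_left fun y => ?_
    rw [real_inner_smul_left]
    ring

/-! ### The inward normal of the thickened domain. -/

/-- Along `n - n'` the two half-space conditions conflict: nearby points would lie both inside and
outside `Ω`. -/
theorem inwardUnitNormal_unique {Ω : Set (EuclideanSpace ℝ (Fin N))}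
    {x n n' : EuclideanSpace ℝ (Fin N)} (h : IsInwardUnitNormal Ω x n)
    (h' : IsInwardUnitNormal Ω x n') : n = n' := by
  by_contra hne
  have hk : ⟪n, n'⟫ < 1 := (inner_lt_one_iff_real_of_norm_eq_one h.1 h'.1).2 hne
  set e := n - n' with he
  have he0 : 0 < ‖e‖ := norm_pos_iff.2 (sub_ne_zero.2 hne)
  have h1 : ⟪n, e⟫ = 1 - ⟪n, n'⟫ := by
    rw [he, inner_sub_right, real_inner_self_eq_norm_sq, h.1]; ring
  have h2 : ⟪n', e⟫ = -(1 - ⟪n, n'⟫) := by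
    rw [he, inner_sub_right, real_inner_self_eq_norm_sq, h'.1, real_inner_comm]; ring
  set κ := 1 - ⟪n, n'⟫ with hκ
  have hκ0 : 0 < κ := by linarith
  have hδ : 0 < κ / (2 * ‖e‖) := by positivity
  obtain ⟨r, hr, H⟩ := h.2 _ hδ
  obtain ⟨r', hr', H'⟩ := h'.2 _ hδ
  set t := min r r' / (2 * ‖e‖) with ht
  have ht0 : 0 < t := by positivity
  have hte : t * ‖e‖ = min r r' / 2 := by rw [ht]; field_simp
  have hm1 : min r r' ≤ r := min_le_left _ _
  have hm2 : min r r' ≤ r' := min_le_right _ _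
  have hm0 : 0 < min r r' := lt_min hr hr'
  have hnorm : ‖x + t • e - x‖ = t * ‖e‖ := by
    rw [add_sub_cancel_left, norm_smul, Real.norm_of_nonneg ht0.le]
  have hprod : κ / (2 * ‖e‖) * (t * ‖e‖) = t * κ / 2 := by field_simp
  have htκ := mul_pos ht0 hκ0
  refine (H' (x + t • e) (by rw [hnorm]; linarith)).2 ?_
    ((H (x + t • e) (by rw [hnorm]; linarith)).1 ?_)
  · rw [hnorm, hprod, add_sub_cancel_left, real_inner_smul_right, h2]; linarith
  · rw [hnorm, hprod, add_sub_cancel_left, real_inner_smul_right, h1]; linarith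

theorem IsInwardUnitNormal.inwardNormal_eq {Ω : Set (EuclideanSpace ℝ (Fin N))}
    {x n : EuclideanSpace ℝ (Fin N)} (h : IsInwardUnitNormal Ω x n) : inwardNormal Ω x = n :=
  inwardUnitNormal_unique (Classical.epsilon_spec (p := IsInwardUnitNormal Ω x) ⟨n, h⟩) h

theorem IsConvexCore.mem_thickDomain_iff (hC : IsConvexCore C)
    {d : EuclideanSpace ℝ (Fin N) → ℝ} {x : EuclideanSpace ℝ (Fin N)} (hx : x ∉ C) :
    x ∈ thickDomain C d ↔ ‖x - nearestPoint C x‖ < d (nearestPoint C x) := by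
  constructor
  · rintro (h | ⟨c, hc, r, hr0, hrd, rfl⟩)
    · exact absurd h hx
    · rw [hC.nearestPoint_add_smul hc hr0, add_sub_cancel_left, norm_smul,
        hC.norm_outwardNormal hc, mul_one, Real.norm_of_nonneg hr0]
      exact hrd
  · intro h
    refine Or.inr ⟨_, hC.nearestPoint_mem_frontier fun h => hx (interior_subset h), _,
      norm_nonneg _, h, ?_⟩
    rw [← hC.sub_nearestPoint hx]
    abel

theorem IsConvexCore.add_smul_outwardNormal_notMem (hC : IsConvexCore C)
    {c : EuclideanSpace ℝ (Fin N)} (hc : c ∈ frontier C) {a : ℝ} (ha : 0 < a) :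
    c + a • outwardNormal C c ∉ C := by
  intro h
  have := hC.inner_outwardNormal_le hc h
  rw [add_sub_cancel_left, real_inner_smul_right, real_inner_self_eq_norm_sq,
    hC.norm_outwardNormal hc] at this
  linarith

theorem IsConvexCore.tendsto_nearestPoint (hC : IsConvexCore C)
    {c : EuclideanSpace ℝ (Fin N)} (hc : c ∈ frontier C) {a : ℝ} (ha : 0 < a) :
    Tendsto (nearestPoint C) (𝓝 (c + a • outwardNormal C c)) (𝓝[frontier C] c) := by
  refine tendsto_nhdsWithin_iff.2 ⟨?_, ?_⟩
  · have : LipschitzWith 1 (nearestPoint C) := LipschitzWith.of_dist_le_mul fun x y => by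
      rw [NNReal.coe_one, one_mul, dist_eq_norm, dist_eq_norm]
      exact hC.norm_nearestPoint_sub_le x y
    have h := this.continuous.tendsto (c + a • outwardNormal C c)
    rwa [hC.nearestPoint_add_smul hc ha.le] at h
  · filter_upwards [hC.isCompact.isClosed.isOpen_compl.mem_nhds
      (hC.add_smul_outwardNormal_notMem hc ha)] with x hx
    exact hC.nearestPoint_mem_frontier fun h => hx (interior_subset h)

/-- The distance to `C` is differentiable off `C`, with gradient the outward normal. -/
theorem IsConvexCore.abs_norm_sub_nearestPoint_sub_le (hC : IsConvexCore C)
    {c : EuclideanSpace ℝ (Fin N)} (hc : c ∈ frontier C) {a : ℝ} (ha : 0 < a)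
    (x : EuclideanSpace ℝ (Fin N)) :
    |‖x - nearestPoint C x‖ - a - ⟪outwardNormal C c, x - (c + a • outwardNormal C c)⟫|
      ≤ (2 * a)⁻¹ * ‖x - (c + a • outwardNormal C c)‖ ^ 2 := by
  have hν1 := hC.norm_outwardNormal hc
  have hle := hC.inner_outwardNormal_le hc (hC.nearestPoint_mem x)
  set ν := outwardNormal C c
  set h := x - (c + a • ν) with hh
  have hxc : x - c = a • ν + h := by rw [hh]; abel
  have h1 : ‖x - nearestPoint C x‖ ≤ ‖x - c‖ :=
    hC.norm_sub_nearestPoint_le (hC.isCompact.isClosed.frontier_subset hc)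
  have h2 : ‖x - c‖ ^ 2 = a ^ 2 + 2 * a * ⟪ν, h⟫ + ‖h‖ ^ 2 := by
    rw [hxc, norm_add_sq_real, norm_smul, hν1, real_inner_smul_left, Real.norm_of_nonneg ha.le]
    ring
  have h3 : a + ⟪ν, h⟫ ≤ ‖x - nearestPoint C x‖ := by
    have e : a + ⟪ν, h⟫ = ⟪ν, x - nearestPoint C x⟫ + ⟪ν, nearestPoint C x - c⟫ := by
      rw [← inner_add_right, sub_add_sub_cancel, hxc, inner_add_right, real_inner_smul_right,
        real_inner_self_eq_norm_sq, hν1]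
      ring
    have := real_inner_le_norm ν (x - nearestPoint C x)
    rw [hν1, one_mul] at this
    linarith
  -- The lower bound `h3` comes from the supporting half-space; the upper one from `h1`, `h2` and
  -- `2a‖x - c‖ ≤ a² + ‖x - c‖²`.
  rw [abs_of_nonneg (by linarith), inv_mul_eq_div, le_div_iff₀ (by positivity)]
  nlinarith [sq_nonneg (‖x - c‖ - a), mul_le_mul_of_nonneg_right h1 ha.le]

/-- With `y` the nearest point to `x`, one has `x - x₀ = (y - c) + (δ - a)ν(y) + a(ν(y) - ν)`.
Pairing with `w ⊥ ν` gives `⟪w + aS*w, y - c⟫` up to `o(‖x - x₀‖)`, which explains the equation for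
`w`. The nearest-point map need only be Lipschitz, not differentiable. -/
theorem InteriorBall.isLittleO_thickness_sub (hC : IsConvexCore C) {R : ℝ} (hR : 0 < R)
    (hB : InteriorBall C R) {c g w : EuclideanSpace ℝ (Fin N)} (hc : c ∈ frontier C)
    {S : EuclideanSpace ℝ (Fin N) →L[ℝ] EuclideanSpace ℝ (Fin N)}
    (hS : HasFDerivWithinAt (outwardNormal C) S (frontier C) c)
    {d : EuclideanSpace ℝ (Fin N) → ℝ} (hd : HasGradientWithinAt d g (frontier C) c)
    (hdc : 0 < d c) (hw : ⟪outwardNormal C c, w⟫ = 0)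
    (hwg : w + d c • ContinuousLinearMap.adjoint S w = g) :
    (fun x => ‖x - nearestPoint C x‖ - d (nearestPoint C x)
      - ⟪outwardNormal C c - w, x - radialMap C d c⟫) =o[𝓝 (radialMap C d c)]
      fun x => x - radialMap C d c := by
  have hx₀ : radialMap C d c = c + d c • outwardNormal C c := rfl
  have hν1 := hC.norm_outwardNormal hc
  have htend := hC.tendsto_nearestPoint hc hdc
  have hquad := hC.abs_norm_sub_nearestPoint_sub_le hc hdc
  have hπ₀ := hC.nearestPoint_add_smul hc hdc.le
  have hnot := hC.add_smul_outwardNormal_notMem hc hdc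
  rw [← hx₀] at htend hquad hπ₀ hnot
  set x₀ := radialMap C d c
  set ν := outwardNormal C c
  set a := d c
  have hLip : ∀ x, ‖nearestPoint C x - c‖ ≤ ‖x - x₀‖ := fun x => by
    have := hC.norm_nearestPoint_sub_le x x₀
    rwa [hπ₀] at this
  have hO : (fun x => nearestPoint C x - c) =O[𝓝 x₀] fun x => x - x₀ :=
    Asymptotics.IsBigO.of_bound' (Eventually.of_forall hLip)
  have o1 : (fun x => ‖x - nearestPoint C x‖ - a - ⟪ν, x - x₀⟫) =o[𝓝 x₀] fun x => x - x₀ := by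
    refine Asymptotics.IsBigO.trans_isLittleO ?_ (isLittleO_norm_sub_sq x₀)
    refine Asymptotics.IsBigO.of_bound (2 * a)⁻¹ (Eventually.of_forall fun x => ?_)
    rw [Real.norm_eq_abs, Real.norm_of_nonneg (by positivity)]
    exact hquad x
  have o2 : (fun x => d (nearestPoint C x) - a - ⟪g, nearestPoint C x - c⟫) =o[𝓝 x₀]
      fun x => x - x₀ :=
    ((hasGradientWithinAt_iff_isLittleO.1 hd).comp_tendsto htend).trans_isBigO hO
  have o3 : (fun x => outwardNormal C (nearestPoint C x) - ν - S (nearestPoint C x - c))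
      =o[𝓝 x₀] fun x => x - x₀ :=
    ((hasFDerivWithinAt_iff_isLittleO.1 hS).comp_tendsto htend).trans_isBigO hO
  have o3' : (fun x => a * ⟪w, outwardNormal C (nearestPoint C x) - ν
      - S (nearestPoint C x - c)⟫) =o[𝓝 x₀] fun x => x - x₀ :=
    (((innerSL ℝ w).isBigO_comp _ _).trans_isLittleO o3).const_mul_left a
  have o4 : (fun x => (‖x - nearestPoint C x‖ - a)
      * ⟪w, outwardNormal C (nearestPoint C x) - ν⟫) =o[𝓝 x₀] fun x => x - x₀ := by
    refine Asymptotics.IsBigO.trans_isLittleO ?_ (isLittleO_norm_sub_sq x₀)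
    refine Asymptotics.IsBigO.of_bound (2 * (‖w‖ * R⁻¹)) ?_
    filter_upwards [htend.eventually self_mem_nhdsWithin] with x hx
    have b1 : |‖x - nearestPoint C x‖ - a| ≤ 2 * ‖x - x₀‖ := by
      have e1 : ‖x₀ - c‖ = a := by
        rw [hx₀, add_sub_cancel_left, norm_smul, hν1, mul_one, Real.norm_of_nonneg hdc.le]
      rw [← e1]
      refine (abs_norm_sub_norm_le _ _).trans ?_
      have e2 : x - nearestPoint C x - (x₀ - c) = (x - x₀) - (nearestPoint C x - c) := by abel
      rw [e2]
      linarith [norm_sub_le (x - x₀) (nearestPoint C x - c), hLip x]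
    have b2 : |⟪w, outwardNormal C (nearestPoint C x) - ν⟫| ≤ ‖w‖ * R⁻¹ * ‖x - x₀‖ := by
      refine (abs_real_inner_le_norm _ _).trans ?_
      rw [mul_assoc]
      gcongr
      refine (hB.norm_outwardNormal_sub_le hC hR hc hx).trans ?_
      gcongr
      exact hLip x
    rw [Real.norm_eq_abs, abs_mul, Real.norm_of_nonneg (by positivity)]
    calc _ ≤ (2 * ‖x - x₀‖) * (‖w‖ * R⁻¹ * ‖x - x₀‖) := by gcongr
      _ = _ := by ring
  refine (((o1.sub o2).add o3').add o4).congr' ?_ EventuallyEq.rfl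
  filter_upwards [hC.isCompact.isClosed.isOpen_compl.mem_nhds hnot] with x hx
  have hsub := hC.sub_nearestPoint hx
  set y := nearestPoint C x
  set δ := ‖x - y‖
  have hxx : x - x₀ = (y - c) + (δ - a) • ν + (δ - a) • (outwardNormal C y - ν)
      + a • (outwardNormal C y - ν) := by
    have : x - x₀ = (y - c) + (x - y) - a • ν := by rw [hx₀]; abel
    rw [this, hsub]
    module
  have e1 : ⟪w, x - x₀⟫ = ⟪w, y - c⟫ + (δ - a) * ⟪w, outwardNormal C y - ν⟫
      + a * ⟪w, outwardNormal C y - ν⟫ := by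
    rw [hxx]
    simp only [inner_add_right, real_inner_smul_right]
    rw [real_inner_comm w ν] at hw
    rw [hw]
    ring
  have e2 : ⟪g, y - c⟫ = ⟪w, y - c⟫ + a * ⟪w, S (y - c)⟫ := by
    rw [← hwg, inner_add_left, real_inner_smul_left, ContinuousLinearMap.adjoint_inner_left]
  rw [inner_sub_left ν w, e1, e2, inner_sub_right w (outwardNormal C y - ν)]
  ring

/-- The inward normal of `Ω_d` at `Φ_d(c)`, in terms of the shape operator and the surface
gradient of `d`. -/
theorem InteriorBall.isInwardUnitNormal (hC : IsConvexCore C) {R : ℝ} (hR : 0 < R)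
    (hB : InteriorBall C R) {c g w : EuclideanSpace ℝ (Fin N)} (hc : c ∈ frontier C)
    {S : EuclideanSpace ℝ (Fin N) →L[ℝ] EuclideanSpace ℝ (Fin N)}
    (hS : HasFDerivWithinAt (outwardNormal C) S (frontier C) c)
    {d : EuclideanSpace ℝ (Fin N) → ℝ} (hd : HasGradientWithinAt d g (frontier C) c)
    (hdc : 0 < d c) (hw : ⟪outwardNormal C c, w⟫ = 0)
    (hwg : w + d c • ContinuousLinearMap.adjoint S w = g) :
    IsInwardUnitNormal (thickDomain C d) (radialMap C d c)
      (‖outwardNormal C c - w‖⁻¹ • (w - outwardNormal C c)) := by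
  have ho := hB.isLittleO_thickness_sub hC hR hc hS hd hdc hw hwg
  have hnot : radialMap C d c ∉ C := hC.add_smul_outwardNormal_notMem hc hdc
  have hν1 := hC.norm_outwardNormal hc
  set x₀ := radialMap C d c
  set ν := outwardNormal C c
  have hm : 0 < ‖ν - w‖ := by
    rw [norm_pos_iff, sub_ne_zero]
    rintro rfl
    rw [real_inner_self_eq_norm_sq, hν1] at hw
    norm_num at hw
  refine ⟨?_, fun ε hε => ?_⟩
  · rw [norm_smul, norm_inv, norm_norm, norm_sub_rev w, inv_mul_cancel₀ hm.ne']
  -- The tolerance carries the factor `‖ν - w‖` that normalization divides out.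
  obtain ⟨r, hr, hball⟩ := Metric.eventually_nhds_iff.1
    ((ho.def (mul_pos hm hε)).and (hC.isCompact.isClosed.isOpen_compl.mem_nhds hnot))
  refine ⟨r, hr, fun x hx => ?_⟩
  obtain ⟨h1, h2⟩ := hball (by rwa [dist_eq_norm])
  rw [Real.norm_eq_abs] at h1
  obtain ⟨h3, h4⟩ := abs_le.1 h1
  have e : ‖ν - w‖ * ⟪‖ν - w‖⁻¹ • (w - ν), x - x₀⟫ = -⟪ν - w, x - x₀⟫ := by
    rw [real_inner_smul_left, mul_inv_cancel_left₀ hm.ne', ← inner_neg_left, neg_sub]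
  rw [hC.mem_thickDomain_iff h2]
  constructor
  · intro h
    have := mul_lt_mul_of_pos_left h hm
    linarith
  · intro h
    have := mul_lt_mul_of_pos_left h hm
    linarith

/-- The tangential slope `w` of the inward normal solves `(1 + a S*) w = g`. -/
theorem exists_add_smul_adjoint_eq {R : ℝ} (hR : 0 < R) {ν g : EuclideanSpace ℝ (Fin N)}
    {S : EuclideanSpace ℝ (Fin N) →L[ℝ] EuclideanSpace ℝ (Fin N)} (hSν : S ν = 0)
    (hS : ∀ v, R * ‖S v‖ ^ 2 ≤ ⟪S v, v⟫) (hg : ⟪ν, g⟫ = 0) {a : ℝ} (ha : 0 < a) :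
    ∃ w, w + a • ContinuousLinearMap.adjoint S w = g ∧ ⟪ν, w⟫ = 0 ∧ ‖w‖ ≤ ‖g‖ ∧
      ‖w - g‖ ≤ a * R⁻¹ * ‖g‖ := by
  set A := ContinuousLinearMap.adjoint S with hA
  have hAS : ∀ u v, ⟪A u, v⟫ = ⟪u, S v⟫ := fun u v => ContinuousLinearMap.adjoint_inner_left S v u
  have hmono : ∀ v, 0 ≤ ⟪A v, v⟫ := fun v => by
    rw [hAS, real_inner_comm]
    exact le_trans (by positivity) (hS v)
  have hSnorm : ‖S‖ ≤ R⁻¹ := S.opNorm_le_bound (by positivity) fun v => by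
    have h1 := (hS v).trans (real_inner_le_norm _ _)
    rw [inv_mul_eq_div, le_div_iff₀ hR]
    rcases (norm_nonneg (S v)).eq_or_lt with h0 | h0
    · rw [← h0, zero_mul]; positivity
    · by_contra hlt
      push Not at hlt
      nlinarith [mul_lt_mul_of_pos_left hlt h0]
  -- Monotonicity makes `1 + aS*` expanding, hence injective, hence bijective in finite dimension;
  -- no symmetry of `S` is used.
  have hle : ∀ v, ‖v‖ ≤ ‖v + a • A v‖ := fun v => by
    have h1 : ‖v‖ ^ 2 ≤ ⟪v + a • A v, v⟫ := by
      rw [inner_add_left, real_inner_smul_left, real_inner_self_eq_norm_sq]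
      nlinarith [mul_nonneg ha.le (hmono v)]
    have h2 := h1.trans (real_inner_le_norm _ _)
    rcases (norm_nonneg v).eq_or_lt with h0 | h0
    · rw [← h0]; positivity
    · by_contra hlt
      push Not at hlt
      nlinarith [mul_lt_mul_of_pos_right hlt h0]
  set T : EuclideanSpace ℝ (Fin N) →ₗ[ℝ] EuclideanSpace ℝ (Fin N) :=
    LinearMap.id + a • (A : EuclideanSpace ℝ (Fin N) →ₗ[ℝ] EuclideanSpace ℝ (Fin N)) with hT
  have hTv : ∀ v, T v = v + a • A v := fun v => by simp [hT]
  have hinj : Function.Injective T := by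
    rw [← LinearMap.ker_eq_bot, LinearMap.ker_eq_bot']
    intro v hv
    have := hle v
    rw [← hTv, hv, norm_zero] at this
    exact norm_le_zero_iff.1 this
  obtain ⟨w, hw⟩ := LinearMap.injective_iff_surjective.1 hinj g
  rw [hTv] at hw
  have hwg : ‖w‖ ≤ ‖g‖ := hw ▸ hle w
  refine ⟨w, hw, ?_, hwg, ?_⟩
  · rw [← hw, inner_add_right, real_inner_smul_right, real_inner_comm, real_inner_comm (A w) ν,
      hAS, hSν, inner_zero_right, mul_zero, add_zero] at hg
    rwa [real_inner_comm]
  · have e : w - g = -(a • A w) := by rw [← hw]; abel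
    rw [e, norm_neg, norm_smul, Real.norm_of_nonneg ha.le, mul_assoc]
    gcongr
    refine (A.le_opNorm w).trans ?_
    rw [hA, LinearIsometryEquiv.norm_map]
    gcongr

/-! ### The first hit of the normal ray. -/

/-- `s` is the smallest nonnegative parameter at which the ray from `c + a ν` with direction
`w - ν` meets `C`. -/
structure IsFirstHit (C : Set (EuclideanSpace ℝ (Fin N)))
    (c w : EuclideanSpace ℝ (Fin N)) (a s : ℝ) : Prop where
  nonneg : 0 ≤ s
  mem : c + a • outwardNormal C c + s • (w - outwardNormal C c) ∈ C
  le : ∀ s', 0 ≤ s' → c + a • outwardNormal C c + s' • (w - outwardNormal C c) ∈ C → s ≤ s'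

theorem norm_outwardNormal_sub_pos (hC : IsConvexCore C) {c w : EuclideanSpace ℝ (Fin N)}
    (hc : c ∈ frontier C) (hw : ⟪outwardNormal C c, w⟫ = 0) : 0 < ‖outwardNormal C c - w‖ := by
  rw [norm_pos_iff, sub_ne_zero]
  intro h
  rw [← h, real_inner_self_eq_norm_sq, hC.norm_outwardNormal hc] at hw
  norm_num at hw

theorem exists_isFirstHit_of_returnDefinedAt (hC : IsConvexCore C)
    {c w : EuclideanSpace ℝ (Fin N)} (hc : c ∈ frontier C)
    {d : EuclideanSpace ℝ (Fin N) → ℝ} (hw : ⟪outwardNormal C c, w⟫ = 0)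
    (hn : IsInwardUnitNormal (thickDomain C d) (radialMap C d c)
      (‖outwardNormal C c - w‖⁻¹ • (w - outwardNormal C c)))
    (hdef : ReturnDefinedAt C d c) :
    ∃ s, IsFirstHit C c w (d c) s ∧
      returnMap C d c = c + d c • outwardNormal C c + s • (w - outwardNormal C c) := by
  obtain ⟨n, hn', t₀, ht₀, hmem₀⟩ := hdef
  rw [inwardUnitNormal_unique hn' hn] at hmem₀
  have hm := norm_outwardNormal_sub_pos hC hc hw
  have hret : returnMap C d c = radialMap C d c +
      sInf {t : ℝ | 0 ≤ t ∧ radialMap C d c + t • inwardNormal (thickDomain C d)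
        (radialMap C d c) ∈ C} • inwardNormal (thickDomain C d) (radialMap C d c) := rfl
  rw [hn.inwardNormal_eq] at hret
  set n := ‖outwardNormal C c - w‖⁻¹ • (w - outwardNormal C c) with hndef
  set T := {t : ℝ | 0 ≤ t ∧ radialMap C d c + t • n ∈ C} with hT
  have hTne : T.Nonempty := ⟨t₀, ht₀, hmem₀⟩
  have hTbdd : BddBelow T := ⟨0, fun t ht => ht.1⟩
  have hTcl : IsClosed T :=
    isClosed_Ici.inter (hC.isCompact.isClosed.preimage
      (by fun_prop : Continuous fun t : ℝ => radialMap C d c + t • n))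
  have hsInf := hTcl.csInf_mem hTne hTbdd
  have hsm : ∀ t : ℝ, (t * ‖outwardNormal C c - w‖⁻¹) • (w - outwardNormal C c) = t • n :=
    fun t => by rw [hndef, smul_smul]
  refine ⟨sInf T * ‖outwardNormal C c - w‖⁻¹, ⟨?_, ?_, fun s' hs' hmem => ?_⟩, ?_⟩
  · exact mul_nonneg hsInf.1 (by positivity)
  · rw [hsm]; exact hsInf.2
  · rw [← div_eq_mul_inv, div_le_iff₀ hm]
    refine csInf_le hTbdd ⟨by positivity, ?_⟩
    rw [← hsm, mul_inv_cancel_right₀ hm.ne']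
    exact hmem
  · rw [hret, hsm]; rfl

theorem returnDefinedAt_of_mem (hC : IsConvexCore C)
    {c w : EuclideanSpace ℝ (Fin N)} (hc : c ∈ frontier C)
    {d : EuclideanSpace ℝ (Fin N) → ℝ} (hw : ⟪outwardNormal C c, w⟫ = 0)
    (hn : IsInwardUnitNormal (thickDomain C d) (radialMap C d c)
      (‖outwardNormal C c - w‖⁻¹ • (w - outwardNormal C c))) {s : ℝ} (hs : 0 ≤ s)
    (hmem : c + d c • outwardNormal C c + s • (w - outwardNormal C c) ∈ C) :
    ReturnDefinedAt C d c := by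
  have hm := norm_outwardNormal_sub_pos hC hc hw
  refine ⟨_, hn, s * ‖outwardNormal C c - w‖, by positivity, ?_⟩
  rw [smul_smul, mul_inv_cancel_right₀ hm.ne']
  exact hmem

/-- With `h = (2a‖w‖)²/R`, the point is `c + (a + h)w - hν`. The first smallness condition gives `h
≤ a`, so the tangential shift is at most `2a‖w‖`; the second gives `h ≤ R`, so depth `h` reaches the
tangent ball. -/
theorem InteriorBall.add_smul_mem (hC : IsConvexCore C) {R : ℝ} (hR : 0 < R)
    (hB : InteriorBall C R) {c w : EuclideanSpace ℝ (Fin N)} (hc : c ∈ frontier C)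
    (hw : ⟪outwardNormal C c, w⟫ = 0) {a : ℝ} (ha : 0 < a) (h1 : 4 * a * ‖w‖ ^ 2 ≤ R)
    (h2 : 2 * a * ‖w‖ ≤ R) :
    c + a • outwardNormal C c + (a + 4 * a ^ 2 * ‖w‖ ^ 2 / R) • (w - outwardNormal C c) ∈ C := by
  have hν1 := hC.norm_outwardNormal hc
  set h := 4 * a ^ 2 * ‖w‖ ^ 2 / R with hh
  have hRh : R * h = 4 * a ^ 2 * ‖w‖ ^ 2 := by rw [hh]; field_simp
  have h0 : 0 ≤ h := by positivity
  have hha : h ≤ a := by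
    rw [hh, div_le_iff₀ hR]
    nlinarith [mul_le_mul_of_nonneg_left h1 ha.le]
  have hhR : h ≤ R := by
    rw [hh, div_le_iff₀ hR]
    have := mul_self_le_mul_self (by positivity : 0 ≤ 2 * a * ‖w‖) h2
    nlinarith
  have e : c + a • outwardNormal C c + (a + h) • (w - outwardNormal C c)
      = c + ((a + h) • w - h • outwardNormal C c) := by module
  rw [e]
  refine hB c hc ?_
  simp only [tangentBall, mem_ofPred_eq, add_sub_cancel_left]
  set ν := outwardNormal C c
  rw [norm_sub_sq_real, norm_smul, norm_smul, hν1, real_inner_smul_right, real_inner_smul_left,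
    inner_sub_right, real_inner_smul_right, real_inner_smul_right, real_inner_comm, hw,
    real_inner_self_eq_norm_sq, hν1, Real.norm_of_nonneg h0,
    Real.norm_of_nonneg (by positivity : 0 ≤ a + h)]
  have h3 : (a + h) ^ 2 * ‖w‖ ^ 2 ≤ (2 * a) ^ 2 * ‖w‖ ^ 2 := by
    gcongr; linarith
  nlinarith [mul_le_mul_of_nonneg_left hhR h0]

theorem IsFirstHit.sub_eq_neg_inner (hC : IsConvexCore C) {c w : EuclideanSpace ℝ (Fin N)}
    (hc : c ∈ frontier C) (hw : ⟪outwardNormal C c, w⟫ = 0) (a s : ℝ) :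
    s - a = -⟪outwardNormal C c,
      c + a • outwardNormal C c + s • (w - outwardNormal C c) - c⟫ := by
  rw [add_assoc, add_sub_cancel_left, inner_add_right, real_inner_smul_right,
    real_inner_smul_right, inner_sub_right, real_inner_self_eq_norm_sq,
    hC.norm_outwardNormal hc, hw]
  ring

theorem IsFirstHit.thickness_le (hC : IsConvexCore C) {c w : EuclideanSpace ℝ (Fin N)}
    (hc : c ∈ frontier C) (hw : ⟪outwardNormal C c, w⟫ = 0) {a s : ℝ}
    (h : IsFirstHit C c w a s) : a ≤ s := by
  have h1 := IsFirstHit.sub_eq_neg_inner hC hc hw a s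
  have h2 := hC.inner_outwardNormal_le hc h.mem
  linarith

/-- For small `a‖w‖` the ray enters the tangent ball. Otherwise `a²‖w‖ ≥ R²/(16M³)`, and the trivial
bound `s - a ≤ D` suffices; hence no smallness of the thickness is assumed. -/
theorem IsFirstHit.sub_le (hC : IsConvexCore C) {R : ℝ} (hR : 0 < R) (hB : InteriorBall C R)
    {c w : EuclideanSpace ℝ (Fin N)} (hc : c ∈ frontier C)
    (hw : ⟪outwardNormal C c, w⟫ = 0) {a s D M : ℝ} (ha : 0 < a) (hM : 1 ≤ M)
    (hD : ∀ y ∈ C, ‖y - c‖ ≤ D) (hwM : ‖w‖ ≤ M) (h : IsFirstHit C c w a s) :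
    s - a ≤ (4 * M / R + D * (16 * M ^ 3 / R ^ 2)) * (a ^ 2 * ‖w‖) := by
  have hD0 : 0 ≤ D := (norm_nonneg _).trans (hD _ h.mem)
  have hw0 := norm_nonneg w
  have hle1 : 0 ≤ 4 * M / R * (a ^ 2 * ‖w‖) := by positivity
  have hle2 : 0 ≤ D * (16 * M ^ 3 / R ^ 2) * (a ^ 2 * ‖w‖) := by positivity
  rw [add_mul]
  by_cases hgood : 4 * a * ‖w‖ ^ 2 ≤ R ∧ 2 * a * ‖w‖ ≤ R
  · have h1 := h.le _ (by positivity) (hB.add_smul_mem hC hR hc hw ha hgood.1 hgood.2)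
    have h2 : 4 * a ^ 2 * ‖w‖ ^ 2 / R ≤ 4 * M / R * (a ^ 2 * ‖w‖) := by
      rw [div_mul_eq_mul_div]
      refine div_le_div_of_nonneg_right ?_ hR.le
      nlinarith [mul_le_mul_of_nonneg_left hwM (by positivity : 0 ≤ 4 * a ^ 2 * ‖w‖)]
    linarith
  · have h1 : R < 4 * M * (a * ‖w‖) := by
      have haw : 0 ≤ a * ‖w‖ := by positivity
      rw [not_and_or, not_le, not_le] at hgood
      rcases hgood with hg | hg
      · nlinarith [mul_le_mul_of_nonneg_left hwM haw]
      · nlinarith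
    have h2 : R < 4 * M * (a * M) := h1.trans_le (by gcongr)
    have h3 : R ^ 2 ≤ 16 * M ^ 3 * (a ^ 2 * ‖w‖) := by
      have := mul_le_mul h1.le h2.le hR.le (by positivity)
      nlinarith
    have h4 : 1 ≤ 16 * M ^ 3 / R ^ 2 * (a ^ 2 * ‖w‖) := by
      rw [div_mul_eq_mul_div, le_div_iff₀ (by positivity), one_mul]
      exact h3
    have h5 : s - a ≤ D := by
      rw [IsFirstHit.sub_eq_neg_inner hC hc hw a s]
      refine (neg_le_abs _).trans ((abs_real_inner_le_norm _ _).trans ?_)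
      rw [hC.norm_outwardNormal hc, one_mul]
      exact hD _ h.mem
    have h6 := mul_le_mul_of_nonneg_left h4 hD0
    linarith

theorem IsFirstHit.norm_sub_le (hC : IsConvexCore C) {R : ℝ} (hR : 0 < R)
    (hB : InteriorBall C R) {c g w : EuclideanSpace ℝ (Fin N)} (hc : c ∈ frontier C)
    (hw : ⟪outwardNormal C c, w⟫ = 0) {a s D M : ℝ} (ha : 0 < a) (hM : 1 ≤ M) (hgM : ‖g‖ ≤ M)
    (hD : ∀ y ∈ C, ‖y - c‖ ≤ D) (hwg : ‖w‖ ≤ ‖g‖) (hwg' : ‖w - g‖ ≤ a * R⁻¹ * ‖g‖)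
    (h : IsFirstHit C c w a s) :
    ‖c + a • outwardNormal C c + s • (w - outwardNormal C c) - c - a • g‖
      ≤ ((4 * M / R + D * (16 * M ^ 3 / R ^ 2)) * (1 + M) + R⁻¹) * a ^ 2 * ‖g‖ := by
  have hD0 : 0 ≤ D := (norm_nonneg _).trans (hD _ h.mem)
  have h1 := h.sub_le hC hR hB hc hw ha hM hD (hwg.trans hgM)
  have h2 := h.thickness_le hC hc hw
  have e : c + a • outwardNormal C c + s • (w - outwardNormal C c) - c - a • g
      = (s - a) • (w - outwardNormal C c) + a • (w - g) := by module
  have h3 : ‖w - outwardNormal C c‖ ≤ 1 + M := by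
    refine (_root_.norm_sub_le _ _).trans ?_
    rw [hC.norm_outwardNormal hc]
    linarith
  set K := 4 * M / R + D * (16 * M ^ 3 / R ^ 2) with hK
  have hK0 : 0 ≤ K := by positivity
  rw [e]
  calc _ ≤ ‖(s - a) • (w - outwardNormal C c)‖ + ‖a • (w - g)‖ := norm_add_le _ _
    _ = (s - a) * ‖w - outwardNormal C c‖ + a * ‖w - g‖ := by
      rw [norm_smul, norm_smul, Real.norm_of_nonneg (by linarith), Real.norm_of_nonneg ha.le]
    _ ≤ (K * (a ^ 2 * ‖g‖)) * (1 + M) + a * (a * R⁻¹ * ‖g‖) := by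
      gcongr
      exact h1.trans (by gcongr)
    _ = _ := by ring

/-- Scaling the thickness by a factor greater than one moves the return point. -/
theorem IsFirstHit.eq_zero_of_eq (hC : IsConvexCore C) {R : ℝ} (hR : 0 < R)
    {c g w w' : EuclideanSpace ℝ (Fin N)} (hc : c ∈ frontier C)
    {S : EuclideanSpace ℝ (Fin N) →L[ℝ] EuclideanSpace ℝ (Fin N)}
    (hS : ∀ v, R * ‖S v‖ ^ 2 ≤ ⟪S v, v⟫)
    (hw : ⟪outwardNormal C c, w⟫ = 0) (hw' : ⟪outwardNormal C c, w'⟫ = 0) {a lam s s' : ℝ}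
    (ha : 0 < a) (hlam : 1 < lam) (hwg : w + a • ContinuousLinearMap.adjoint S w = g)
    (hwg' : w' + (lam * a) • ContinuousLinearMap.adjoint S w' = lam • g)
    (h : IsFirstHit C c w a s)
    (heq : c + (lam * a) • outwardNormal C c + s' • (w' - outwardNormal C c)
      = c + a • outwardNormal C c + s • (w - outwardNormal C c)) : g = 0 := by
  have h1 := IsFirstHit.sub_eq_neg_inner hC hc hw a s
  have h2 := IsFirstHit.sub_eq_neg_inner hC hc hw' (lam * a) s'
  rw [heq, ← h1] at h2
  have hs := h.thickness_le hC hc hw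
  -- Equality of the normal components; `hsw` is equality of the tangential ones.
  have hs' : s' = s + (lam - 1) * a := by linarith
  have hpos : 0 < (lam - 1) * a := mul_pos (by linarith) ha
  have hsw : s' • w' = s • w := by
    have e : s' • w' = (c + (lam * a) • outwardNormal C c + s' • (w' - outwardNormal C c))
        - c + (s' - lam * a) • outwardNormal C c := by module
    rw [e, heq, h2]
    module
  set A := ContinuousLinearMap.adjoint S with hA
  have hmono : 0 ≤ ⟪A w, w⟫ := by
    rw [hA, ContinuousLinearMap.adjoint_inner_left, real_inner_comm]
    exact le_trans (by positivity) (hS w)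
  -- Apply `1 + λaS*` to `s'w' = sw` and substitute both slope equations, which eliminates `w'` and
  -- `g`.
  have key : s • w + (lam * a) • s • A w = (s' * lam) • w + (s' * lam * a) • A w := by
    have e1 : s' • (w' + (lam * a) • A w') = s' • lam • g := by rw [hwg']
    rw [← hwg, smul_add, smul_comm s' (lam * a), ← map_smul A s', hsw, map_smul] at e1
    rw [e1]
    module
  have key' := congrArg (fun v => ⟪v, w⟫) key
  simp only [inner_add_left, real_inner_smul_left, real_inner_self_eq_norm_sq] at key'
  have hw0 : ‖w‖ = 0 := by
    by_contra hne
    have hwpos : 0 < ‖w‖ ^ 2 := by positivity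
    have e2 : (s' * lam - s) * ‖w‖ ^ 2 + (lam * a * (s' - s)) * ⟪A w, w⟫ = 0 := by linarith
    have e3 : 0 < s' * lam - s := by nlinarith
    have e4 : 0 ≤ lam * a * (s' - s) := mul_nonneg (by positivity) (by linarith)
    nlinarith [mul_pos e3 hwpos, mul_nonneg e4 hmono]
  rw [norm_eq_zero] at hw0
  rw [← hwg, hw0, map_zero, smul_zero, add_zero]

theorem IsFirstHit.eq_of_zero (hC : IsConvexCore C) {c : EuclideanSpace ℝ (Fin N)}
    (hc : c ∈ frontier C) {a s : ℝ} (ha : 0 < a) (h : IsFirstHit C c 0 a s) : s = a := by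
  refine le_antisymm (h.le a ha.le ?_) (h.thickness_le hC hc (inner_zero_right _))
  rw [zero_sub, smul_neg, add_neg_cancel_right]
  exact hC.isCompact.isClosed.frontier_subset hc

/-! ### Return maps and conclusion. -/

theorem InteriorBall.exists_slope (hC : IsConvexCore C) {R : ℝ} (hR : 0 < R)
    (hB : InteriorBall C R) {c : EuclideanSpace ℝ (Fin N)} (hc : c ∈ frontier C)
    {S : EuclideanSpace ℝ (Fin N) →L[ℝ] EuclideanSpace ℝ (Fin N)}
    (hS : HasFDerivWithinAt (outwardNormal C) S (frontier C) c)
    (hSν : S (outwardNormal C c) = 0) (hS' : ∀ v, R * ‖S v‖ ^ 2 ≤ ⟪S v, v⟫)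
    {d : EuclideanSpace ℝ (Fin N) → ℝ} (hd : IsThickness C d) :
    ∃ w, w + d c • ContinuousLinearMap.adjoint S w = surfaceGradient C d c ∧
      ⟪outwardNormal C c, w⟫ = 0 ∧ ‖w‖ ≤ ‖surfaceGradient C d c‖ ∧
      ‖w - surfaceGradient C d c‖ ≤ d c * R⁻¹ * ‖surfaceGradient C d c‖ ∧
      IsInwardUnitNormal (thickDomain C d) (radialMap C d c)
        (‖outwardNormal C c - w‖⁻¹ • (w - outwardNormal C c)) := by
  have hg := hB.hasSurfaceGradientAt hC hR hc hd
  obtain ⟨w, h1, h2, h3, h4⟩ := exists_add_smul_adjoint_eq hR hSν hS'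
    (g := surfaceGradient C d c) (by rw [real_inner_comm]; exact hg.1) (hd.pos c hc)
  exact ⟨w, h1, h2, h3, h4, hB.isInwardUnitNormal hC hR hc hS hg.2 (hd.pos c hc) h2 h1⟩

/-- The threshold `R/(4M²)` secures both smallness conditions of `add_smul_mem`, the second because
`M ≥ 1`. -/
theorem InteriorBall.returnDefinedAt (hC : IsConvexCore C) {R : ℝ} (hR : 0 < R)
    (hB : InteriorBall C R) {c : EuclideanSpace ℝ (Fin N)} (hc : c ∈ frontier C)
    {d : EuclideanSpace ℝ (Fin N) → ℝ} (hd : IsThickness C d) {M : ℝ} (hM : 1 ≤ M)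
    (hg : ‖surfaceGradient C d c‖ ≤ M) (hdc : d c ≤ R / (4 * M ^ 2)) :
    ReturnDefinedAt C d c := by
  obtain ⟨S, hS, hSν, hS'⟩ := hB.exists_shapeOperator hC hR hc
  obtain ⟨w, -, hw, hwg, -, hn⟩ := hB.exists_slope hC hR hc hS hSν hS' hd
  have hpos := hd.pos c hc
  have hwM := hwg.trans hg
  rw [le_div_iff₀ (by positivity)] at hdc
  refine returnDefinedAt_of_mem hC hc hw hn (by positivity)
    (hB.add_smul_mem hC hR hc hw hpos ?_ ?_)
  · calc 4 * d c * ‖w‖ ^ 2 ≤ 4 * d c * M ^ 2 := by gcongr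
      _ ≤ R := by linarith
  · calc 2 * d c * ‖w‖ ≤ 2 * d c * M := by gcongr
      _ ≤ d c * (4 * M ^ 2) := by nlinarith [mul_le_mul_of_nonneg_left hM hpos.le,
          mul_le_mul_of_nonneg_left hM (by positivity : 0 ≤ d c * M)]
      _ ≤ R := hdc

theorem InteriorBall.norm_returnMap_sub_le (hC : IsConvexCore C) {R : ℝ} (hR : 0 < R)
    (hB : InteriorBall C R) {c : EuclideanSpace ℝ (Fin N)} (hc : c ∈ frontier C)
    {d : EuclideanSpace ℝ (Fin N) → ℝ} (hd : IsThickness C d) {D M : ℝ} (hM : 1 ≤ M)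
    (hD : ∀ y ∈ C, ‖y - c‖ ≤ D) (hg : ‖surfaceGradient C d c‖ ≤ M)
    (hdef : ReturnDefinedAt C d c) :
    ‖returnMap C d c - c - leadingDisplacement C d c‖
      ≤ ((4 * M / R + D * (16 * M ^ 3 / R ^ 2)) * (1 + M) + R⁻¹) * d c ^ 2
        * ‖surfaceGradient C d c‖ := by
  obtain ⟨S, hS, hSν, hS'⟩ := hB.exists_shapeOperator hC hR hc
  obtain ⟨w, -, hw, hwg, hwg', hn⟩ := hB.exists_slope hC hR hc hS hSν hS' hd
  obtain ⟨s, hs, hret⟩ := exists_isFirstHit_of_returnDefinedAt hC hc hw hn hdef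
  rw [hret]
  exact hs.norm_sub_le hC hR hB hc hw (hd.pos c hc) hM hg hD hwg hwg'

theorem InteriorBall.returnMap_const_mul_eq_iff (hC : IsConvexCore C) {R : ℝ} (hR : 0 < R)
    (hB : InteriorBall C R) {c : EuclideanSpace ℝ (Fin N)} (hc : c ∈ frontier C)
    {d : EuclideanSpace ℝ (Fin N) → ℝ} (hd : IsThickness C d) {lam : ℝ} (hlam : 0 < lam)
    (hdef : ReturnDefinedAt C d c) (hdef' : ReturnDefinedAt C (fun x => lam * d x) c) :
    returnMap C (fun x => lam * d x) c = returnMap C d c ↔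
      lam = 1 ∨ surfaceGradient C d c = 0 := by
  obtain ⟨S, hS, hSν, hS'⟩ := hB.exists_shapeOperator hC hR hc
  obtain ⟨w, hwS, hw, hwg, -, hn⟩ := hB.exists_slope hC hR hc hS hSν hS' hd
  obtain ⟨s, hs, hret⟩ := exists_isFirstHit_of_returnDefinedAt hC hc hw hn hdef
  have hd' := hd.const_mul hlam
  have hsg := hB.surfaceGradient_const_mul hC hR hc hd hlam
  obtain ⟨w', hwS', hw', hwg₂, -, hn'⟩ := hB.exists_slope hC hR hc hS hSν hS' hd'
  obtain ⟨s', hs', hret'⟩ := exists_isFirstHit_of_returnDefinedAt hC hc hw' hn' hdef'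
  have hpos := hd.pos c hc
  rw [hsg] at hwS' hwg₂
  constructor
  · intro heq
    rw [hret, hret'] at heq
    rcases lt_trichotomy lam 1 with h1 | h1 | h1
    · right
      have h0 : lam • surfaceGradient C d c = 0 := by
        -- The roles are exchanged: `d` is `λ⁻¹ > 1` times the thickness `λd`.
        refine IsFirstHit.eq_zero_of_eq hC hR hc hS' hw' hw (lam := lam⁻¹) (s' := s)
          (mul_pos hlam hpos) ((one_lt_inv₀ hlam).2 h1) hwS' ?_ hs' ?_
        · rw [inv_mul_cancel_left₀ hlam.ne', inv_smul_smul₀ hlam.ne', hwS]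
        · rw [inv_mul_cancel_left₀ hlam.ne', heq]
      exact (smul_eq_zero.1 h0).resolve_left hlam.ne'
    · exact Or.inl h1
    · exact Or.inr (hs.eq_zero_of_eq hC hR hc hS' hw hw' hpos h1 hwS hwS' heq)
  · rintro (rfl | h0)
    · simp only [one_mul]
    -- Both slopes vanish, so both rays run straight back along `ν` to `c`.
    · rw [h0, norm_zero] at hwg
      rw [h0, smul_zero, norm_zero] at hwg₂
      obtain rfl := norm_le_zero_iff.1 hwg
      obtain rfl := norm_le_zero_iff.1 hwg₂
      rw [hret, hret', hs.eq_of_zero hC hc hpos, hs'.eq_of_zero hC hc (mul_pos hlam hpos)]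
      simp only [zero_sub, smul_neg, add_neg_cancel_right]

theorem proposition6p2 {N : ℕ} (C : Set (EuclideanSpace ℝ (Fin N))) (hC : IsConvexCore C)
    (M : ℝ) :
    ∃ K δ : ℝ, 0 < K ∧ 0 < δ ∧
      ∀ (d : EuclideanSpace ℝ (Fin N) → ℝ), IsThickness C d → ∀ lam : ℝ, 0 < lam →
        ∀ c ∈ frontier C, ‖surfaceGradient C d c‖ ≤ M → lam * ‖surfaceGradient C d c‖ ≤ M →
          -- for small thickness both return maps are defined at `c`
          (d c ≤ δ → ReturnDefinedAt C d c) ∧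
          (lam * d c ≤ δ → ReturnDefinedAt C (fun x => lam * d x) c) ∧
          -- first-order expansions of both return maps
          (ReturnDefinedAt C d c →
            ‖returnMap C d c - c - leadingDisplacement C d c‖
              ≤ K * d c ^ 2 * ‖surfaceGradient C d c‖) ∧
          (ReturnDefinedAt C (fun x => lam * d x) c →
            ‖returnMap C (fun x => lam * d x) c - c
                - leadingDisplacement C (fun x => lam * d x) c‖
              ≤ K * (lam * d c) ^ 2 * (lam * ‖surfaceGradient C d c‖)) ∧
          -- same line field to first order, namely the gradient line field of `d`
          Submodule.span ℝ {leadingDisplacement C d c}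
            = Submodule.span ℝ {surfaceGradient C d c} ∧
          Submodule.span ℝ {leadingDisplacement C (fun x => lam * d x) c}
            = Submodule.span ℝ {surfaceGradient C d c} ∧
          -- the speed along it is multiplied by `lam ^ 2`, so it changes unless `lam = 1`
          leadingDisplacement C (fun x => lam * d x) c = lam ^ 2 • leadingDisplacement C d c ∧
          (lam ≠ 1 → surfaceGradient C d c ≠ 0 →
            ‖leadingDisplacement C (fun x => lam * d x) c‖ ≠ ‖leadingDisplacement C d c‖) ∧
          -- the discrete maps differ at every noncritical point unless `lam = 1`
          (ReturnDefinedAt C d c → ReturnDefinedAt C (fun x => lam * d x) c →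
            (returnMap C (fun x => lam * d x) c = returnMap C d c ↔
              lam = 1 ∨ surfaceGradient C d c = 0)) := by
  obtain ⟨R, hR, hB⟩ : ∃ R, 0 < R ∧ InteriorBall C R := hC.exists_tangentBall_subset
  obtain ⟨D, hD⟩ := Metric.isBounded_iff.1 hC.isCompact.isBounded
  -- The estimates need a gradient bound at least `1`, whereas `M` is arbitrary.
  have hM : 1 ≤ max M 1 := le_max_right _ _
  have hM0 : 0 < max M 1 := by linarith
  have hD0 : 0 ≤ max D 0 := le_max_right _ _
  refine ⟨(4 * max M 1 / R + max D 0 * (16 * max M 1 ^ 3 / R ^ 2)) * (1 + max M 1) + R⁻¹,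
    R / (4 * max M 1 ^ 2), by positivity, by positivity, fun d hd lam hlam c hc hg hg' => ?_⟩
  have hD' : ∀ y ∈ C, ‖y - c‖ ≤ max D 0 := fun y hy => by
    rw [← dist_eq_norm]
    exact (hD hy (hC.isCompact.isClosed.frontier_subset hc)).trans (le_max_left _ _)
  have hpos := hd.pos c hc
  -- The claims about `λd` are those about a single thickness, applied to `λd`, whose gradient norm
  -- `λ‖∇d‖` is also at most `M`; so the same constants serve.
  have hd' := hd.const_mul hlam
  have hsg := hB.surfaceGradient_const_mul hC hR hc hd hlam
  have hnorm : ‖surfaceGradient C (fun x => lam * d x) c‖ = lam * ‖surfaceGradient C d c‖ := by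
    rw [hsg, norm_smul, Real.norm_of_nonneg hlam.le]
  have hgM := hg.trans (le_max_left M 1)
  have hgM' := hnorm.trans_le (hg'.trans (le_max_left M 1))
  have hlead : leadingDisplacement C (fun x => lam * d x) c
      = lam ^ 2 • leadingDisplacement C d c := by
    rw [leadingDisplacement, leadingDisplacement, hsg]
    module
  have hspan : Submodule.span ℝ {leadingDisplacement C d c}
      = Submodule.span ℝ {surfaceGradient C d c} :=
    Submodule.span_singleton_smul_eq hpos.ne'.isUnit _
  refine ⟨hB.returnDefinedAt hC hR hc hd hM hgM, hB.returnDefinedAt hC hR hc hd' hM hgM',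
    hB.norm_returnMap_sub_le hC hR hc hd hM hD' hgM, fun hdef => ?_, hspan, ?_, hlead,
    fun hne hg0 heq => ?_, hB.returnMap_const_mul_eq_iff hC hR hc hd hlam⟩
  · rw [← hnorm]
    exact hB.norm_returnMap_sub_le hC hR hc hd' hM hD' hgM' hdef
  · rw [hlead, Submodule.span_singleton_smul_eq (pow_pos hlam 2).ne'.isUnit, hspan]
  · have hV : ‖leadingDisplacement C d c‖ ≠ 0 :=
      norm_ne_zero_iff.2 (smul_ne_zero hpos.ne' hg0)
    rw [hlead, norm_smul, Real.norm_of_nonneg (by positivity), mul_eq_right₀ hV] at heq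
    exact hne ((pow_eq_one_iff_of_nonneg hlam.le two_ne_zero).1 heq)
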